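/- **Conventions.** A *2-complex* is a finite simplicial complex of dimension at most 2. An edge is *free* if it lies in exactly one 2-simplex; a 2-simplex is *free* if at least one of its edges is free; a 2-complex is *closed* if it has no free edge. A *collapse* $Y\searrow Y'$ removes all free 2-simplexes of $Y$ together with one free edge of each. Starting from $Y^{(0)}=Y$ let $Y^{(i)}\searrow Y^{(i+1)}$; $Y$ is *collapsible to a graph in at most $k$ steps* if $\dim Y^{(k)}\le 1$ (the set of 2-simplexes of $Y^{(k)}$ does not depend on the choices made). For a 2-simplex $\sigma$ of $Y$ put $D_Y(\sigma)=\sup\{i:\sigma\subset Y^{(i)}\}\in\{0,1,\dots,\infty\}$. Two distinct 2-simplexes are adjacent if they share an edge; $d_Y$ is the resulting path distance on 2-simplexes (with value $\infty$ if there is no path). An *$r$-pseudo-surface* is a finite 2-dimensional simplicial complex in which every maximal simplex is 2-dimensional, any two 2-simplexes are at finite distance, and every edge lies in at most $r$ 2-simplexes. Let $\mathcal L_{k,r}$ be the set of isomorphism types of $r$-pseudo-surfaces $S$ having a 2-simplex $\sigma_*$ such that $D_S(\sigma_*)=k$ if $S$ is not closed, and $d_S(\sigma_*,\sigma)\le k$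 for every 2-simplex $\sigma$ of $S$. For a 2-complex $S$ with $f(S)>0$ 2-simplexes and $v(S)$ vertices let $\mu(S)=v(S)/f(S)$ and $\tilde\mu(S)=\min\mu(S')$, the minimum over all subcomplexes $S'\subset S$ with $f(S')>0$. Put $\tilde\mu_{k,r}=\max_{S\in\mathcal L_{k,r}}\tilde\mu(S)$. Let $p=p(n)\in(0,1)$. A random 2-complex $Y\in G(\Delta_n^{(2)},p)$ has vertex set $\{1,\dots,n\}$, contains every edge, and contains each of the $\binom n3$ 2-simplexes independently with probability $p$. We write $a_n\ll b_n$ (or $b_n\gg a_n$) if $a_n>0$ for all large $n$ and $a_n/b_n\to0$ as $n\to\infty$; "a.a.s." means with probability tending to $1$ as $n\to\infty$. **Theorem.** Let $k\ge1$ and $r\ge2$ be integers. The maximum defining $\tilde\mu_{k,r}$ exists, and: (a) if $p\ll n^{-1-\frac{2}{r+1}}$ and $p\ll n^{-\tilde\mu_{k,r}}$, then $Y\in G(\Delta_n^{(2)},p)$ is collapsible to a graph in at most $k$ steps, a.a.s.; (b) if $p\gg n^{-\tilde\mu_{k,r}}$, then $Y\in G(\Delta_n^{(2)},p)$ is not collapsible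 to a graph in $k$ or fewer steps, a.a.s. -/

import Mathlib

open Filter Topology

namespace RandomComplex

/-- A finite-or-infinite abstract simplicial complex with vertices among the elements of `V`
(not every element of `V` has to be a vertex). -/
abbrev Complex (V : Type*) := PreAbstractSimplicialComplex V

variable {V : Type*}

/-- `K` has no simplexes of dimension greater than `d`. -/
def DimLE (K : Complex V) (d : ℕ) : Prop :=
  ∀ s ∈ K.faces, s.card ≤ d + 1

/-- `e` is an edge (1-simplex) of `K`. -/
def IsEdge (K : Complex V) (e : Finset V) : Prop :=
  e ∈ K.faces ∧ e.card = 2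

/-- `t` is a triangle (2-simplex) of `K`. -/
def IsTriangle (K : Complex V) (t : Finset V) : Prop :=
  t ∈ K.faces ∧ t.card = 3

/-- The type of 2-simplexes of `K`. -/
abbrev Triangle (K : Complex V) := {t : Finset V // IsTriangle K t}

/-- An edge is free if it is included in exactly one 2-simplex. -/
def IsFreeEdge (K : Complex V) (e : Finset V) : Prop :=
  IsEdge K e ∧ ∃! t, IsTriangle K t ∧ e ⊆ t

/-- A 2-simplex is free if at least one of its edges is free. -/
def IsFreeTriangle (K : Complex V) (t : Finset V) : Prop :=
  IsTriangle K t ∧ ∃ e, e ⊆ t ∧ IsFreeEdge K e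

/-- `K` is closed if `∂K = ∅`, i.e. there are no free edges. -/
def IsClosedComplex (K : Complex V) : Prop :=
  ∀ e, ¬ IsFreeEdge K e

/-! ### Collapses -/

/-- `L` is obtained from `K` by collapsing all free 2-simplexes: for each free triangle `t` one
free edge `φ t` of it is chosen, and all the free triangles together with the chosen edges are
removed. (If there are no free triangles, this says `L = K`.) -/
def CollapseStep (K L : Complex V) : Prop :=
  ∃ φ : Finset V → Finset V,
    (∀ t, IsFreeTriangle K t → φ t ⊆ t ∧ IsFreeEdge K (φ t)) ∧
    L.faces = K.faces \ ({t | IsFreeTriangle K t} ∪ φ '' {t | IsFreeTriangle K t})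

/-- `Collapses i K L`: `L` is a possible `K^(i)`, i.e. there is a sequence of simplicial collapses
`K = K^(0) ↘ K^(1) ↘ ⋯ ↘ K^(i) = L`. -/
def Collapses : ℕ → Complex V → Complex V → Prop
  | 0, K, L => K = L
  | i + 1, K, L => ∃ M, Collapses i K M ∧ CollapseStep M L

/-- `K` is collapsible to a graph in at most `k` steps: `K^(k)` is a graph. -/
def CollapsibleToGraph (k : ℕ) (K : Complex V) : Prop :=
  ∃ L, Collapses k K L ∧ DimLE L 1

/-- `D_K(σ) = sup {i | σ ∈ K^(i)} ∈ {0, 1, …, ∞}`. -/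
noncomputable def collapseTime (K : Complex V) (σ : Finset V) : ℕ∞ :=
  sSup {x | ∃ i : ℕ, x = (i : ℕ∞) ∧ ∃ L, Collapses i K L ∧ σ ∈ L.faces}

/-! ### Pseudo-surfaces and the family `𝓛_{k,r}` -/

/-- The graph whose vertices are the 2-simplexes of `K`; two distinct 2-simplexes are adjacent
if they have an edge in common. -/
def dualGraph (K : Complex V) : SimpleGraph (Triangle K) where
  Adj s t := s ≠ t ∧ ∃ e : Finset V, e.card = 2 ∧ e ⊆ s.1 ∧ e ⊆ t.1
  symm := ⟨fun _ _ h => ⟨h.1.symm, h.2.imp fun _ he => ⟨he.1, he.2.2, he.2.1⟩⟩⟩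
  loopless := ⟨fun _ h => h.1 rfl⟩

/-- Every maximal simplex is 2-dimensional. -/
def IsPure (K : Complex V) : Prop :=
  ∀ s, Maximal (· ∈ K.faces) s → s.card = 3

/-- The diameter (the largest distance between two 2-simplexes) is finite. -/
def StronglyConnected (K : Complex V) : Prop :=
  (dualGraph K).ediam ≠ ⊤

/-- Every edge is incident to at most `r` 2-simplexes. -/
def DegreeLE (K : Complex V) (r : ℕ) : Prop :=
  ∀ e, IsEdge K e → {t | IsTriangle K t ∧ e ⊆ t}.encard ≤ r

/-- An `r`-pseudo-surface: a finite, pure, strongly connected 2-dimensional simplicial complex of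
degree at most `r`. -/
structure IsPseudoSurface (r : ℕ) (K : Complex V) : Prop where
  finite : K.faces.Finite
  dim_le : DimLE K 2
  exists_triangle : ∃ t, IsTriangle K t
  pure : IsPure K
  stronglyConnected : StronglyConnected K
  degree_le : DegreeLE K r

/-- The forbidden `r`-pseudo-surfaces `𝓛_{k,r}`: those `r`-pseudo-surfaces with a 2-simplex
`c` (the center) such that `D_S(c) = k` if `∂S ≠ ∅`, and every 2-simplex is at distance at most
`k` from `c`. Every isomorphism type of finite complexes is represented by complexes whose
vertices are natural numbers. -/
def forbidden (k r : ℕ) : Set (Complex ℕ) :=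
  {S | IsPseudoSurface r S ∧ ∃ c : Triangle S,
    (¬ IsClosedComplex S → collapseTime S c.1 = (k : ℕ∞)) ∧
    ∀ t : Triangle S, (dualGraph S).edist c t ≤ (k : ℕ∞)}

/-! ### The invariants `μ`, `μ̃` and `μ̃_{k,r}` -/

/-- The number `v(K)` of vertices. -/
noncomputable def numVertices (K : Complex V) : ℕ := {s | s ∈ K.faces ∧ s.card = 1}.ncard

/-- The number `f(K)` of faces (2-simplexes). -/
noncomputable def numTriangles (K : Complex V) : ℕ := {t | IsTriangle K t}.ncard

/-- `μ(K) = v(K) / f(K)`, used for `f(K) > 0` only. -/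
noncomputable def mu (K : Complex V) : ℝ := (numVertices K : ℝ) / (numTriangles K : ℝ)

/-- `μ̃(S)` is the minimum of `μ(S')` over the subcomplexes `S'` of `S` having at least one face
(for a finite complex `S` with a face this is the minimum of a finite nonempty set). -/
noncomputable def muTilde (S : Complex V) : ℝ :=
  sInf {x | ∃ S' : Complex V, S' ≤ S ∧ 0 < numTriangles S' ∧ x = mu S'}

/-- `μ̃_{k,r}`, the largest value of `μ̃(S)` for `S ∈ 𝓛_{k,r}`. -/
noncomputable def muTildeMax (k r : ℕ) : ℝ := sSup (muTilde '' forbidden k r)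

/-! ### The Linial-Meshulam model `G(Δ_n^(2), p)` -/

/-- The 2-complex on the vertex set `Fin n` that contains the full 1-skeleton and whose set of
2-simplexes is `F`. Each `Y` with `Δ_n^(1) ⊆ Y ⊆ Δ_n^(2)` is of this form for a unique `F`. -/
def ofTriangles {n : ℕ} (F : Finset {t : Finset (Fin n) // t.card = 3}) : Complex (Fin n) where
  faces := {s | s.Nonempty ∧ (s.card ≤ 2 ∨ ∃ t ∈ F, s = t.1)}
  isRelLowerSet_faces := by
    rintro s ⟨hs, h⟩
    refine ⟨hs, fun t hts ht => ⟨ht, ?_⟩⟩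
    have hle : t.card ≤ s.card := Finset.card_le_card hts
    rcases h with h | ⟨u, hu, rfl⟩
    · exact Or.inl (hle.trans h)
    · by_cases h3 : t.card = 3
      · exact Or.inr ⟨u, hu, Finset.eq_of_subset_of_card_le hts (by rw [h3, u.2])⟩
      · left
        have := u.2
        omega

open Classical in
/-- The probability that a random 2-complex `Y ∈ G(Δ_n^(2), p)` has the property `Q`, where
`P(Y) = p^f(Y) (1 - p)^(C(n,3) - f(Y))`. -/
noncomputable def prob (n : ℕ) (p : ℝ) (Q : Complex (Fin n) → Prop) : ℝ :=
  ∑ F : Finset {t : Finset (Fin n) // t.card = 3},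
    if Q (ofTriangles F) then p ^ F.card * (1 - p) ^ (n.choose 3 - F.card) else 0

/-- `a ≪ b`: `a_n > 0` (for all large `n`) and `a_n / b_n → 0`. -/
def MuchLess (a b : ℕ → ℝ) : Prop :=
  (∀ᶠ n in atTop, 0 < a n) ∧ Tendsto (fun n => a n / b n) atTop (𝓝 0)

end RandomComplex

open RandomComplex

/-! Collapsing is governed by the family of 2-simplexes alone: one step deletes the members having
an edge that lies in no other member, which is `core`. Hence a complex of dimension at most 2
collapses to a graph in `k` steps exactly when `core^[k]` of its triangles is empty
(`collapsibleToGraph_iff`). Since `core` is monotone and commutes with injective relabelling, an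
obstruction in a subfamily obstructs the whole family, and everything can be moved to vertices in
`ℕ`.

For (a), take a minimal subfamily `X` with `core^[k] X` nonempty. If an edge lies in more than `r`
members, then `r + 1` of them span at most `r + 3` vertices, which gives the exponent `1 + 2/(r+1)`.
Otherwise `X` generates a forbidden pseudo-surface (`gen_mem_forbidden_of_minimal`): survival for
`k` steps is decided in a ball of radius `k`, so minimality confines `X` to that ball, and survival
for one more step would make `X` closed. Forbidden surfaces have at most `(3r)^k` triangles, so in
this case `X` contains a bounded subfamily with at most `muTildeMax k r` vertices per triangle. A
first moment bound rules out both kinds of dense subfamily (`tendsto_bern_hasDense`).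

For (b), the size bound leaves finitely many values of `muTilde`, so some forbidden `S` attains the
maximum. Every nonempty subfamily of its triangles has at least `muTildeMax k r` vertices per
triangle, so all expected copy counts diverge, and the second moment method produces a copy of `S`
(`tendsto_bern_forall_not_map_subset`). Some triangle of that copy survives `k` collapses. -/

namespace RandomComplex

/-! ### Collapsing families of 3-sets -/

section Core

variable {V W : Type*}

/-- The members of a family of 3-sets all of whose edges lie in another member. -/
def core (F : Set (Finset V)) : Set (Finset V) :=
  {t ∈ F | ∀ e ⊆ t, e.card = 2 → ∃ t' ∈ F, t' ≠ t ∧ e ⊆ t'}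

theorem core_subset (F : Set (Finset V)) : core F ⊆ F := fun _ h => h.1

theorem core_mono {F G : Set (Finset V)} (h : F ⊆ G) : core F ⊆ core G := by
  rintro t ⟨ht, h'⟩
  refine ⟨h ht, fun e he hc => ?_⟩
  obtain ⟨t', ht', hne, hsub⟩ := h' e he hc
  exact ⟨t', h ht', hne, hsub⟩

theorem core_iterate_mono {F G : Set (Finset V)} (h : F ⊆ G) (k : ℕ) :
    core^[k] F ⊆ core^[k] G := by
  induction k with
  | zero => exact h
  | succ k ih => simpa only [Function.iterate_succ_apply'] using core_mono ih

theorem core_iterate_anti (F : Set (Finset V)) {i j : ℕ} (h : i ≤ j) :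
    core^[j] F ⊆ core^[i] F := by
  induction j, h using Nat.le_induction with
  | base => exact subset_rfl
  | succ j _ ih =>
    rw [Function.iterate_succ_apply']
    exact (core_subset _).trans ih

theorem core_iterate_subset (F : Set (Finset V)) (k : ℕ) : core^[k] F ⊆ F :=
  core_iterate_anti F (Nat.zero_le k)

theorem core_iterate_of_core_eq {F : Set (Finset V)} (h : core F = F) (k : ℕ) :
    core^[k] F = F := Function.iterate_fixed h k

theorem core_image (g : V ↪ W) (F : Set (Finset V)) :
    core (Finset.map g '' F) = Finset.map g '' core F := by
  ext s
  constructor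
  · rintro ⟨⟨t, ht, rfl⟩, h⟩
    refine ⟨t, ⟨ht, fun e he hc => ?_⟩, rfl⟩
    obtain ⟨_, ⟨t', ht', rfl⟩, hne, hsub⟩ :=
      h (e.map g) (Finset.map_subset_map.2 he) (by simpa using hc)
    exact ⟨t', ht', fun h => hne (h ▸ rfl), Finset.map_subset_map.1 hsub⟩
  · rintro ⟨t, ⟨ht, h⟩, rfl⟩
    refine ⟨⟨t, ht, rfl⟩, fun e he hc => ?_⟩
    obtain ⟨e', he', rfl⟩ := Finset.subset_map_iff.1 he
    obtain ⟨t', ht', hne, hsub⟩ := h e' he' (by simpa using hc)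
    exact ⟨_, ⟨t', ht', rfl⟩, fun h => hne (Finset.map_injective g h),
      Finset.map_subset_map.2 hsub⟩

theorem core_iterate_image (g : V ↪ W) (F : Set (Finset V)) (k : ℕ) :
    core^[k] (Finset.map g '' F) = Finset.map g '' core^[k] F := by
  induction k with
  | zero => rfl
  | succ k ih => simp only [Function.iterate_succ_apply', ih, core_image]

end Core

/-! ### Collapses of complexes in terms of their triangles -/

section Collapse

variable {V : Type*}

/-- The set of 2-simplexes of a complex. -/
def triangles (K : Complex V) : Set (Finset V) := {t | IsTriangle K t}

theorem face_of_subset (K : Complex V) {s t : Finset V} (hs : s ∈ K.faces) (hts : t ⊆ s)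
    (ht : t.Nonempty) : t ∈ K.faces :=
  (K.isRelLowerSet_faces hs).2 hts ht

theorem isEdge_of_subset (K : Complex V) {e t : Finset V} (ht : IsTriangle K t) (he : e ⊆ t)
    (hc : e.card = 2) : IsEdge K e :=
  ⟨face_of_subset K ht.1 he (Finset.card_pos.1 (by omega)), hc⟩

/-- An edge of `t` already lies in `t`, so it fails to be free exactly when a second triangle
contains it. -/
theorem mem_core_triangles_iff {K : Complex V} {t : Finset V} :
    t ∈ core (triangles K) ↔ IsTriangle K t ∧ ¬ IsFreeTriangle K t := by
  constructor
  · rintro ⟨ht, h⟩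
    refine ⟨ht, ?_⟩
    rintro ⟨-, e, he, hfree, s, hs, huniq⟩
    obtain ⟨t', ht', hne, hsub⟩ := h e he hfree.2
    exact hne ((huniq t' ⟨ht', hsub⟩).trans (huniq t ⟨ht, he⟩).symm)
  · rintro ⟨ht, h⟩
    refine ⟨ht, fun e he hc => ?_⟩
    by_contra! hcon
    refine h ⟨ht, e, he, isEdge_of_subset K ht he hc, t, ⟨ht, he⟩, ?_⟩
    rintro t' ⟨ht', hsub⟩
    by_contra hne
    exact hcon t' ht' hne hsub

theorem isClosedComplex_iff {K : Complex V} :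
    IsClosedComplex K ↔ core (triangles K) = triangles K := by
  constructor
  · intro h
    refine (core_subset _).antisymm fun t ht => mem_core_triangles_iff.2 ⟨ht, ?_⟩
    rintro ⟨-, e, -, he⟩
    exact h e he
  · rintro h e he
    obtain ⟨t, ⟨ht, het⟩, -⟩ := id he.2
    have ht' : t ∈ triangles K := ht
    rw [← h] at ht'
    exact (mem_core_triangles_iff.1 ht').2 ⟨ht, e, het, he⟩

/-- The chosen free edges have two vertices, so removing them never removes a triangle; the choice
`φ` therefore has no influence on the result. -/
theorem CollapseStep.triangles_eq {K L : Complex V} (h : CollapseStep K L) :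
    triangles L = core (triangles K) := by
  obtain ⟨φ, hφ, hL⟩ := h
  ext t
  rw [mem_core_triangles_iff]
  constructor
  · rintro ⟨ht, hc⟩
    rw [hL] at ht
    exact ⟨⟨ht.1, hc⟩, fun hfree => ht.2 (Or.inl hfree)⟩
  · rintro ⟨ht, hfree⟩
    refine ⟨?_, ht.2⟩
    rw [hL]
    refine ⟨ht.1, ?_⟩
    rintro (h | ⟨s, hs, rfl⟩)
    · exact hfree h
    · have h2 := (hφ s hs).2.1.2
      have h3 := ht.2
      omega

theorem CollapseStep.faces_subset {K L : Complex V} (h : CollapseStep K L) :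
    L.faces ⊆ K.faces := by
  obtain ⟨φ, hφ, hL⟩ := h
  rw [hL]
  exact Set.sdiff_subset

theorem Collapses.triangles_eq {k : ℕ} {K L : Complex V} (h : Collapses k K L) :
    triangles L = core^[k] (triangles K) := by
  induction k generalizing L with
  | zero => cases h; rfl
  | succ k ih =>
    obtain ⟨M, hM, hL⟩ := h
    rw [hL.triangles_eq, ih hM, Function.iterate_succ_apply']

theorem Collapses.faces_subset {k : ℕ} {K L : Complex V} (h : Collapses k K L) :
    L.faces ⊆ K.faces := by
  induction k generalizing L with
  | zero => cases h; rfl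
  | succ k ih =>
    obtain ⟨M, hM, hL⟩ := h
    exact hL.faces_subset.trans (ih hM)

/-- What remains must be closed under subsets. A removed free edge lies in a single triangle, which
is removed too, and in dimension at most 2 nothing else properly contains a removed simplex. -/
theorem exists_collapseStep {K : Complex V} (hK : DimLE K 2) : ∃ L, CollapseStep K L := by
  have hex : ∀ t, ∃ e, IsFreeTriangle K t → e ⊆ t ∧ IsFreeEdge K e := by
    intro t
    by_cases h : IsFreeTriangle K t
    · obtain ⟨-, e, he, hfree⟩ := id h
      exact ⟨e, fun _ => ⟨he, hfree⟩⟩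
    -- Default value: only the images of free triangles are removed.
    · exact ⟨∅, fun h' => absurd h' h⟩
  choose φ hφ using hex
  refine ⟨⟨K.faces \ ({t | IsFreeTriangle K t} ∪ φ '' {t | IsFreeTriangle K t}), ?_⟩,
    φ, hφ, rfl⟩
  rintro s ⟨hs, hsn⟩
  refine ⟨(K.isRelLowerSet_faces hs).1, fun t hts ht => ⟨face_of_subset K hs hts ht, ?_⟩⟩
  have hs3 := hK s hs
  rintro (h | ⟨u, hu, rfl⟩)
  · have h3 : t.card = 3 := h.1.2
    have : t = s := Finset.eq_of_subset_of_card_le hts (by omega)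
    exact hsn (Or.inl (this ▸ h))
  · have h2 := (hφ u hu).2.1.2
    have hle := Finset.card_le_card hts
    by_cases h3 : s.card = 3
    · obtain ⟨w, -, huniq⟩ := (hφ u hu).2.2
      have : s = u := (huniq s ⟨⟨hs, h3⟩, hts⟩).trans (huniq u ⟨hu.1, (hφ u hu).1⟩).symm
      exact hsn (Or.inl (this ▸ hu))
    · have : φ u = s := Finset.eq_of_subset_of_card_le hts (by omega)
      exact hsn (Or.inr ⟨u, hu, this⟩)

theorem exists_collapses {K : Complex V} (hK : DimLE K 2) (k : ℕ) : ∃ L, Collapses k K L := by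
  induction k with
  | zero => exact ⟨K, rfl⟩
  | succ k ih =>
    obtain ⟨M, hM⟩ := ih
    obtain ⟨L, hL⟩ := exists_collapseStep (K := M) fun s hs => hK s (hM.faces_subset hs)
    exact ⟨L, M, hM, hL⟩

theorem collapsibleToGraph_iff {K : Complex V} (hK : DimLE K 2) (k : ℕ) :
    CollapsibleToGraph k K ↔ core^[k] (triangles K) = ∅ := by
  constructor
  · rintro ⟨L, hL, hdim⟩
    rw [← hL.triangles_eq, Set.eq_empty_iff_forall_notMem]
    rintro t ⟨ht, hc⟩
    have := hdim t ht
    omega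
  · intro h
    obtain ⟨L, hL⟩ := exists_collapses hK k
    refine ⟨L, hL, fun s hs => ?_⟩
    have h3 := hK s (hL.faces_subset hs)
    by_contra hlt
    have : s ∈ triangles L := ⟨hs, by omega⟩
    rw [hL.triangles_eq, h] at this
    exact this

theorem le_collapseTime {K : Complex V} (hK : DimLE K 2) {k : ℕ} {t : Finset V}
    (ht : t ∈ core^[k] (triangles K)) : (k : ℕ∞) ≤ collapseTime K t := by
  obtain ⟨L, hL⟩ := exists_collapses hK k
  rw [← hL.triangles_eq] at ht
  exact le_sSup ⟨k, rfl, L, hL, ht.1⟩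

theorem collapseTime_le {K : Complex V} {k : ℕ} {t : Finset V} (ht : IsTriangle K t)
    (h : t ∉ core^[k + 1] (triangles K)) : collapseTime K t ≤ k := by
  refine sSup_le ?_
  rintro _ ⟨i, rfl, L, hL, hmem⟩
  by_contra! hlt
  have hi : k + 1 ≤ i := by exact_mod_cast hlt
  have : t ∈ triangles L := ⟨hmem, ht.2⟩
  rw [hL.triangles_eq] at this
  exact h (core_iterate_anti _ hi this)

theorem mem_core_of_collapseTime_eq {K : Complex V} {k : ℕ} (hk : 1 ≤ k) {t : Finset V}
    (ht : IsTriangle K t) (h : collapseTime K t = k) : t ∈ core^[k] (triangles K) := by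
  obtain ⟨j, rfl⟩ : ∃ j, k = j + 1 := ⟨k - 1, by omega⟩
  by_contra hcon
  have := collapseTime_le ht hcon
  rw [h] at this
  have : j + 1 ≤ j := by exact_mod_cast this
  omega

end Collapse

/-! ### Complexes generated by families of 3-sets -/

section Gen

variable {V : Type*}

/-- The complex generated by a family of sets. -/
def gen (X : Set (Finset V)) : Complex V where
  faces := {s | s.Nonempty ∧ ∃ t ∈ X, s ⊆ t}
  isRelLowerSet_faces := by
    rintro s ⟨hs, t, ht, hst⟩
    exact ⟨hs, fun u hus hu => ⟨hu, t, ht, Finset.Subset.trans hus hst⟩⟩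

theorem triangles_gen {X : Set (Finset V)} (hX : ∀ t ∈ X, t.card = 3) :
    triangles (gen X) = X := by
  ext t
  constructor
  · rintro ⟨⟨-, u, hu, htu⟩, hc⟩
    rwa [Finset.eq_of_subset_of_card_le htu (by rw [hX u hu, hc])]
  · intro ht
    exact ⟨⟨Finset.card_pos.1 (by rw [hX t ht]; norm_num), t, ht, subset_rfl⟩, hX t ht⟩

theorem dimLE_gen {X : Set (Finset V)} (hX : ∀ t ∈ X, t.card = 3) : DimLE (gen X) 2 := by
  rintro s ⟨-, t, ht, hst⟩
  have := Finset.card_le_card hst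
  have := hX t ht
  omega

theorem gen_triangles_le (K : Complex V) : gen (triangles K) ≤ K := by
  rintro s ⟨hs, t, ht, hst⟩
  exact face_of_subset K ht.1 hst hs

theorem isPure_gen {X : Set (Finset V)} (hX : ∀ t ∈ X, t.card = 3) : IsPure (gen X) := by
  rintro s ⟨⟨hs, t, ht, hst⟩, hmax⟩
  have htf : t ∈ (gen X).faces :=
    ⟨Finset.card_pos.1 (by rw [hX t ht]; norm_num), t, ht, subset_rfl⟩
  have : t ≤ s := hmax htf hst
  rw [Finset.Subset.antisymm hst this, hX t ht]

theorem finite_gen {X : Set (Finset V)} (hX : X.Finite) : (gen X).faces.Finite := by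
  refine (hX.biUnion fun t _ => (t.powerset : Finset (Finset V)).finite_toSet).subset ?_
  rintro s ⟨-, t, ht, hst⟩
  exact Set.mem_biUnion ht (by simpa using hst)

/-- The support of a family of sets. -/
noncomputable def supp [DecidableEq V] (X : Finset (Finset V)) : Finset V := X.biUnion id

theorem numVertices_eq [DecidableEq V] (K : Complex V) (A : Finset V)
    (h : ∀ v, {v} ∈ K.faces ↔ v ∈ A) : numVertices K = A.card := by
  have : {s | s ∈ K.faces ∧ s.card = 1} = (fun v => ({v} : Finset V)) '' (A : Set V) := by
    ext s
    constructor
    · rintro ⟨hs, hc⟩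
      obtain ⟨v, rfl⟩ := Finset.card_eq_one.1 hc
      exact ⟨v, (h v).1 hs, rfl⟩
    · rintro ⟨v, hv, rfl⟩
      exact ⟨(h v).2 hv, Finset.card_singleton v⟩
  rw [numVertices, this, Set.ncard_image_of_injective _ Finset.singleton_injective,
    Set.ncard_coe_finset]

theorem numVertices_gen [DecidableEq V] (X : Finset (Finset V)) :
    numVertices (gen (X : Set (Finset V))) = (supp X).card := by
  refine numVertices_eq _ _ fun v => ?_
  constructor
  · rintro ⟨-, t, ht, hst⟩
    exact Finset.mem_biUnion.2 ⟨t, ht, by simpa using hst⟩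
  · intro hv
    obtain ⟨t, ht, hvt⟩ := Finset.mem_biUnion.1 hv
    exact ⟨Finset.singleton_nonempty v, t, ht, by simpa using hvt⟩

theorem numTriangles_gen {X : Finset (Finset V)} (hX : ∀ t ∈ X, t.card = 3) :
    numTriangles (gen (X : Set (Finset V))) = X.card := by
  have : {t | IsTriangle (gen (X : Set (Finset V))) t} = X :=
    triangles_gen (X := (X : Set (Finset V))) hX
  rw [numTriangles, this, Set.ncard_coe_finset]

theorem card_supp_le [DecidableEq V] {X : Finset (Finset V)} (hX : ∀ t ∈ X, t.card = 3) :
    (supp X).card ≤ 3 * X.card := by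
  rw [mul_comm]
  exact Finset.card_biUnion_le_card_mul _ _ _ fun t ht => (hX t ht).le

theorem subset_supp [DecidableEq V] {X : Finset (Finset V)} {t : Finset V} (h : t ∈ X) :
    t ⊆ supp X := Finset.subset_biUnion_of_mem id h

theorem mu_nonneg (K : Complex V) : 0 ≤ mu K := by unfold mu; positivity

theorem muTilde_le {S S' : Complex V} (h : S' ≤ S) (hS' : 0 < numTriangles S') :
    muTilde S ≤ mu S' :=
  csInf_le ⟨0, by rintro _ ⟨T, -, -, rfl⟩; exact mu_nonneg T⟩ ⟨S', h, hS', rfl⟩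

end Gen

/-! ### Balls in graphs of bounded degree -/

section Ball

theorem exists_edist_le_one_of_edist_le_succ {α : Type*} {G : SimpleGraph α} {c u : α} {k : ℕ}
    (h : G.edist c u ≤ ((k + 1 : ℕ) : ℕ∞)) :
    ∃ s, G.edist c s ≤ 1 ∧ G.edist s u ≤ (k : ℕ∞) := by
  obtain ⟨p, hp⟩ := G.exists_walk_of_edist_ne_top (ne_top_of_le_ne_top (ENat.natCast_ne_top _) h)
  rw [← hp] at h
  have hlen : p.length ≤ k + 1 := by exact_mod_cast h
  cases p with
  | nil => exact ⟨c, by simp, by simp⟩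
  | cons hadj q =>
    refine ⟨_, (SimpleGraph.edist_eq_one_iff_adj.2 hadj).le, (G.edist_le q).trans ?_⟩
    rw [SimpleGraph.Walk.length_cons] at hlen
    exact_mod_cast Nat.le_of_succ_le_succ hlen

open Classical in
-- `D` bounds closed unit balls, centre included, and a ball of radius `k + 1` is covered by the
-- `k`-balls around the points of a unit ball.
theorem card_ball_le {α : Type*} [Fintype α] (G : SimpleGraph α) (D : ℕ)
    (hD : ∀ c, (Finset.univ.filter fun u => G.edist c u ≤ 1).card ≤ D) (k : ℕ) (c : α) :
    (Finset.univ.filter fun u => G.edist c u ≤ (k : ℕ∞)).card ≤ D ^ k := by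
  induction k generalizing c with
  | zero =>
    refine Finset.card_le_one.2 fun a ha b hb => ?_
    have ha' := (Finset.mem_filter.1 ha).2
    have hb' := (Finset.mem_filter.1 hb).2
    simp only [Nat.cast_zero, nonpos_iff_eq_zero, SimpleGraph.edist_eq_zero_iff] at ha' hb'
    exact ha'.symm.trans hb'
  | succ k ih =>
    calc _ ≤ ((Finset.univ.filter fun u => G.edist c u ≤ 1).biUnion fun s =>
          Finset.univ.filter fun u => G.edist s u ≤ (k : ℕ∞)).card := by
          refine Finset.card_le_card fun u hu => ?_
          obtain ⟨s, hs, hsu⟩ :=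
            exists_edist_le_one_of_edist_le_succ (Finset.mem_filter.1 hu).2
          exact Finset.mem_biUnion.2 ⟨s, by simpa using hs, by simpa using hsu⟩
      _ ≤ (Finset.univ.filter fun u => G.edist c u ≤ 1).card * D ^ k :=
          Finset.card_biUnion_le_card_mul _ _ _ fun s _ => ih s
      _ ≤ D * D ^ k := Nat.mul_le_mul_right _ (hD c)
      _ = D ^ (k + 1) := (pow_succ' D k).symm

theorem exists_edge_of_edist_le_one {V : Type*} {K : Complex V} {s t : Triangle K}
    (h : (dualGraph K).edist s t ≤ 1) : ∃ e ⊆ s.1, e.card = 2 ∧ e ⊆ t.1 := by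
  rcases SimpleGraph.edist_le_one_iff_adj_or_eq.1 h with ⟨-, e, hc, hs, ht⟩ | rfl
  · exact ⟨e, hs, hc, ht⟩
  · obtain ⟨e, he, hc⟩ := Finset.exists_subset_card_eq (show 2 ≤ s.1.card by rw [s.2.2]; norm_num)
    exact ⟨e, he, hc, he⟩

theorem edist_le_one_of_edge {V : Type*} {K : Complex V} {s t : Triangle K} {e : Finset V}
    (hc : e.card = 2) (hs : e ⊆ s.1) (ht : e ⊆ t.1) : (dualGraph K).edist s t ≤ 1 := by
  rw [SimpleGraph.edist_le_one_iff_adj_or_eq]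
  by_cases h : s = t
  · exact Or.inr h
  · exact Or.inl ⟨h, e, hc, hs, ht⟩

/-- A complex of degree at most `r` has at most `(3r)^k` 2-simplexes at distance at most `k` from
a given one. -/
theorem numTriangles_le {V : Type*} {K : Complex V} (hfin : K.faces.Finite) {r k : ℕ}
    (hr : DegreeLE K r) (c : Triangle K)
    (hc : ∀ t : Triangle K, (dualGraph K).edist c t ≤ (k : ℕ∞)) :
    numTriangles K ≤ (3 * r) ^ k := by
  classical
  have hfin' : {t | IsTriangle K t}.Finite := hfin.subset fun t ht => ht.1
  let _ : Fintype (Triangle K) := hfin'.fintype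
  have hball := card_ball_le (dualGraph K) (3 * r) ?_ k c
  · have huniv : (Finset.univ.filter fun u => (dualGraph K).edist c u ≤ (k : ℕ∞)) =
        Finset.univ := Finset.filter_true_of_mem fun u _ => hc u
    rw [huniv] at hball
    refine le_trans (le_of_eq ?_) hball
    rw [numTriangles, Finset.card_univ, ← Nat.card_eq_fintype_card]
    rfl
  · intro s
    -- The closed unit ball is covered by the triangles through the three edges of `s`, at most `r`
    -- for each edge.
    have hsub : (Finset.univ.filter fun u => (dualGraph K).edist s u ≤ 1) ⊆
        (s.1.powersetCard 2).biUnion fun e => Finset.univ.filter fun u : Triangle K => e ⊆ u.1 := by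
      intro u hu
      obtain ⟨e, hes, he, heu⟩ := exists_edge_of_edist_le_one (Finset.mem_filter.1 hu).2
      exact Finset.mem_biUnion.2 ⟨e, Finset.mem_powersetCard.2 ⟨hes, he⟩, by simpa using heu⟩
    have h3 : (s.1.powersetCard 2).card = 3 := by
      rw [Finset.card_powersetCard, s.2.2]; rfl
    refine (Finset.card_le_card hsub).trans ?_
    rw [← h3]
    refine Finset.card_biUnion_le_card_mul _ _ _ fun e he => ?_
    obtain ⟨hes, he⟩ := Finset.mem_powersetCard.1 he
    have hdeg := hr e (isEdge_of_subset K s.2 hes he)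
    have himg : ((Finset.univ.filter fun u : Triangle K => e ⊆ u.1).map
        (Function.Embedding.subtype _) : Set (Finset V)) = {t | IsTriangle K t ∧ e ⊆ t} := by
      ext t
      simp [and_comm]
    rw [← himg, Set.encard_coe_eq_coe_finsetCard, Finset.card_map] at hdeg
    exact_mod_cast hdeg

end Ball

/-! ### The forbidden pseudo-surfaces -/

section Forbidden

theorem numTriangles_le_of_forbidden {k r : ℕ} {S : Complex ℕ} (hS : S ∈ forbidden k r) :
    numTriangles S ≤ (3 * r) ^ k := by
  obtain ⟨hS, c, -, hc⟩ := hS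
  exact numTriangles_le hS.finite hS.degree_le c hc

/-- Vertex and triangle counts of subcomplexes are bounded, so the infimum runs over a finite set
and is attained. Discarding everything not under a triangle can only lose vertices, so the minimizer
may be taken to be generated by its triangles. -/
theorem exists_muTilde_eq {S : Complex ℕ} (hfin : S.faces.Finite)
    (htri : ∃ t, IsTriangle S t) :
    ∃ H : Finset (Finset ℕ), (H : Set (Finset ℕ)) ⊆ triangles S ∧ H.Nonempty ∧
      muTilde S = (supp H).card / H.card := by
  have hfint : {t | IsTriangle S t}.Finite := hfin.subset fun t ht => ht.1
  have hfinv : {s | s ∈ S.faces ∧ s.card = 1}.Finite := hfin.subset fun t ht => ht.1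
  set A := {x | ∃ S' : Complex ℕ, S' ≤ S ∧ 0 < numTriangles S' ∧ x = mu S'} with hA
  have hAfin : A.Finite := by
    refine (((Set.finite_Iic (numVertices S)).prod (Set.finite_Iic (numTriangles S))).image
      fun q : ℕ × ℕ => (q.1 : ℝ) / q.2).subset ?_
    rintro _ ⟨S', hle, -, rfl⟩
    exact ⟨(numVertices S', numTriangles S'),
      ⟨Set.ncard_le_ncard (fun s hs => ⟨hle hs.1, hs.2⟩) hfinv,
        Set.ncard_le_ncard (fun s hs => ⟨hle hs.1, hs.2⟩) hfint⟩, rfl⟩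
  have hAne : A.Nonempty :=
    ⟨mu S, S, le_rfl, (Set.ncard_pos hfint).2 htri, rfl⟩
  obtain ⟨S', hle, hpos, hmu⟩ : sInf A ∈ A := hAne.csInf_mem hAfin
  have hfin' : (triangles S').Finite := hfint.subset fun t ht => ⟨hle ht.1, ht.2⟩
  have hH3 : ∀ t ∈ hfin'.toFinset, t.card = 3 := fun t ht => ((hfin'.mem_toFinset).1 ht).2
  have hcard : hfin'.toFinset.card = numTriangles S' :=
    (Set.ncard_eq_toFinset_card (triangles S') hfin').symm
  have hgen : gen (hfin'.toFinset : Set (Finset ℕ)) ≤ S' := by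
    rw [hfin'.coe_toFinset]
    exact gen_triangles_le S'
  refine ⟨hfin'.toFinset, ?_, ?_, le_antisymm ?_ ?_⟩
  · rw [hfin'.coe_toFinset]
    exact fun t ht => ⟨hle ht.1, ht.2⟩
  · rw [← Finset.card_pos, hcard]
    exact hpos
  · have := muTilde_le (S := S) (hgen.trans hle)
      (by rw [numTriangles_gen hH3, hcard]; exact hpos)
    rwa [mu, numVertices_gen, numTriangles_gen hH3] at this
  · rw [muTilde, ← hA, hmu, mu, hcard, ← numVertices_gen]
    refine div_le_div_of_nonneg_right ?_ (Nat.cast_nonneg _)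
    have hsub : {s | s ∈ (gen (hfin'.toFinset : Set (Finset ℕ))).faces ∧ s.card = 1} ⊆
        {s | s ∈ S'.faces ∧ s.card = 1} := fun s hs => ⟨hgen hs.1, hs.2⟩
    exact_mod_cast Set.ncard_le_ncard hsub (hfinv.subset fun s hs => ⟨hle hs.1, hs.2⟩)

theorem exists_muTilde_eq_of_forbidden {k r : ℕ} {S : Complex ℕ} (hS : S ∈ forbidden k r) :
    ∃ H : Finset (Finset ℕ), (H : Set (Finset ℕ)) ⊆ triangles S ∧ H.Nonempty ∧
      H.card ≤ (3 * r) ^ k ∧ muTilde S = (supp H).card / H.card := by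
  obtain ⟨H, hHS, hne, hmu⟩ := exists_muTilde_eq hS.1.finite hS.1.exists_triangle
  refine ⟨H, hHS, hne, le_trans ?_ (numTriangles_le_of_forbidden hS), hmu⟩
  rw [← Set.ncard_coe_finset]
  exact Set.ncard_le_ncard hHS (hS.1.finite.subset fun t ht => ht.1)

/-- `forbidden k r` contains all relabellings of its members, but the values are quotients of
bounded natural numbers. -/
theorem finite_muTilde_image (k r : ℕ) : (muTilde '' forbidden k r).Finite := by
  refine (((Set.finite_Iic (3 * (3 * r) ^ k)).prod (Set.finite_Iic ((3 * r) ^ k))).image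
    fun q : ℕ × ℕ => (q.1 : ℝ) / q.2).subset ?_
  rintro _ ⟨S, hS, rfl⟩
  obtain ⟨H, hHS, -, hcard, hmu⟩ := exists_muTilde_eq_of_forbidden hS
  exact ⟨((supp H).card, H.card),
    ⟨(card_supp_le fun t ht => (hHS ht).2).trans (Nat.mul_le_mul_left 3 hcard), hcard⟩, hmu.symm⟩

theorem gen_mem_forbidden {k r : ℕ} {X : Finset (Finset ℕ)} (hX : ∀ t ∈ X, t.card = 3)
    (hr : ∀ e : Finset ℕ, e.card = 2 → (X.filter (e ⊆ ·)).card ≤ r)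
    (c : Triangle (gen (X : Set (Finset ℕ))))
    (hc : ∀ t, (dualGraph (gen (X : Set (Finset ℕ)))).edist c t ≤ (k : ℕ∞))
    (hcore : core (X : Set (Finset ℕ)) ≠ X →
      c.1 ∈ core^[k] (X : Set (Finset ℕ)) ∧ c.1 ∉ core^[k + 1] (X : Set (Finset ℕ))) :
    gen (X : Set (Finset ℕ)) ∈ forbidden k r := by
  have htri : triangles (gen (X : Set (Finset ℕ))) = X :=
    triangles_gen (X := (X : Set (Finset ℕ))) hX
  have hdim : DimLE (gen (X : Set (Finset ℕ))) 2 := dimLE_gen hX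
  refine ⟨⟨finite_gen X.finite_toSet, hdim, ⟨c.1, c.2⟩, isPure_gen hX, ?_, ?_⟩, c, ?_, hc⟩
  -- Going through the centre bounds the diameter by `2k`.
  · refine ne_top_of_le_ne_top (ENat.natCast_ne_top (k + k))
      (SimpleGraph.ediam_le_of_edist_le fun u v => ?_)
    refine ((dualGraph _).edist_triangle (v := c)).trans ?_
    rw [Nat.cast_add, SimpleGraph.edist_comm]
    exact add_le_add (hc u) (hc v)
  · intro e he
    have : {t | IsTriangle (gen (X : Set (Finset ℕ))) t ∧ e ⊆ t} = X.filter (e ⊆ ·) := by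
      ext t
      have : IsTriangle (gen (X : Set (Finset ℕ))) t ↔ t ∈ X := Set.ext_iff.1 htri t
      simp [this]
    rw [this, Set.encard_coe_eq_coe_finsetCard]
    exact_mod_cast hr e he.2
  · intro hncl
    rw [isClosedComplex_iff, htri] at hncl
    obtain ⟨h1, h2⟩ := hcore hncl
    exact le_antisymm (collapseTime_le c.2 (htri.symm ▸ h2))
      (le_collapseTime hdim (htri.symm ▸ h1))

/-- The boundary of a tetrahedron is forbidden. -/
theorem tetrahedron_mem_forbidden {k r : ℕ} (hk : 1 ≤ k) (hr : 2 ≤ r) :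
    gen (((Finset.range 4).powersetCard 3 : Finset (Finset ℕ)) : Set (Finset ℕ)) ∈
      forbidden k r := by
  have hX : ∀ t ∈ (Finset.range 4).powersetCard 3, t.card = 3 := fun t ht =>
    (Finset.mem_powersetCard.1 ht).2
  have htri : triangles (gen (((Finset.range 4).powersetCard 3 : Finset (Finset ℕ)) :
      Set (Finset ℕ))) = _ := triangles_gen hX
  have hmem : ({0, 1, 2} : Finset ℕ) ∈ triangles (gen (((Finset.range 4).powersetCard 3 :
      Finset (Finset ℕ)) : Set (Finset ℕ))) := by
    rw [htri]
    exact Finset.mem_coe.2 (by decide)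
  refine gen_mem_forbidden hX (fun e he => ?_) ⟨{0, 1, 2}, hmem⟩ (fun t => ?_) (fun h => ?_)
  · by_cases h : e ⊆ Finset.range 4
    · have : ∀ e ∈ (Finset.range 4).powersetCard 2,
          (((Finset.range 4).powersetCard 3).filter (e ⊆ ·)).card ≤ 2 := by decide
      exact (this e (Finset.mem_powersetCard.2 ⟨h, he⟩)).trans hr
    · rw [Finset.filter_false_of_mem fun t ht het =>
        h (het.trans (Finset.mem_powersetCard.1 ht).1)]
      simp
  · have ht : t.1 ∈ (Finset.range 4).powersetCard 3 := by
      have : t.1 ∈ triangles _ := t.2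
      rw [htri] at this
      exact this
    have key : ∀ t ∈ (Finset.range 4).powersetCard 3,
        ∃ e ∈ Finset.powersetCard 2 ({0, 1, 2} : Finset ℕ), e ⊆ t := by decide
    obtain ⟨e, he, het⟩ := key t.1 ht
    rw [Finset.mem_powersetCard] at he
    refine (edist_le_one_of_edge he.2 he.1 het).trans ?_
    exact_mod_cast hk
  -- The tetrahedron boundary is closed, so the collapse-time condition is vacuous.
  · refine absurd ((core_subset _).antisymm fun t ht => ⟨ht, fun e he hc => ?_⟩) h
    have key : ∀ t ∈ (Finset.range 4).powersetCard 3, ∀ e ∈ Finset.powersetCard 2 t,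
        ∃ t' ∈ (Finset.range 4).powersetCard 3, t' ≠ t ∧ e ⊆ t' := by decide
    exact key t ht e (Finset.mem_powersetCard.2 ⟨he, hc⟩)

theorem isGreatest_muTildeMax {k r : ℕ} (hk : 1 ≤ k) (hr : 2 ≤ r) :
    IsGreatest (muTilde '' forbidden k r) (muTildeMax k r) := by
  have hfin := finite_muTilde_image k r
  have hne : (muTilde '' forbidden k r).Nonempty :=
    ⟨_, _, tetrahedron_mem_forbidden hk hr, rfl⟩
  exact ⟨hne.csSup_mem hfin, fun x hx => le_csSup hfin.bddAbove hx⟩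

/-- Whether a 2-simplex survives `i` collapses depends only on the ball of radius `i` around it. -/
theorem mem_core_iterate_of_ball_subset {V : Type*} {K : Complex V} {B : Set (Finset V)} (i : ℕ)
    (t : Triangle K) (ht : t.1 ∈ core^[i] (triangles K))
    (hB : ∀ u, (dualGraph K).edist t u ≤ (i : ℕ∞) → u.1 ∈ B) : t.1 ∈ core^[i] B := by
  induction i generalizing t with
  | zero => exact hB t (by simp)
  | succ i ih =>
    rw [Function.iterate_succ_apply'] at ht ⊢
    refine ⟨ih t ht.1 fun u hu => hB u (hu.trans ?_), fun e he hc => ?_⟩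
    · exact_mod_cast Nat.le_succ i
    · obtain ⟨t', ht', hne, het'⟩ := ht.2 e he hc
      have htK : IsTriangle K t' := core_iterate_subset _ _ ht'
      -- The `i`-ball around a neighbour of `t` lies in the `(i + 1)`-ball around `t`.
      refine ⟨t', ih ⟨t', htK⟩ ht' fun u hu => hB u ?_, hne, het'⟩
      refine ((dualGraph K).edist_triangle (v := ⟨t', htK⟩)).trans ?_
      rw [Nat.cast_succ, add_comm (i : ℕ∞)]
      exact add_le_add (edist_le_one_of_edge hc he het') hu

/-- A minimal family of degree at most `r` that survives `k` collapses generates a forbidden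
pseudo-surface. -/
theorem gen_mem_forbidden_of_minimal {k r : ℕ} {X : Finset (Finset ℕ)}
    (hX : ∀ t ∈ X, t.card = 3)
    (hr : ∀ e : Finset ℕ, e.card = 2 → (X.filter (e ⊆ ·)).card ≤ r)
    (hmin : Minimal (fun Z : Finset (Finset ℕ) => (core^[k] (Z : Set (Finset ℕ))).Nonempty) X) :
    gen (X : Set (Finset ℕ)) ∈ forbidden k r := by
  classical
  obtain ⟨c, hc⟩ := hmin.prop
  have htri : triangles (gen (X : Set (Finset ℕ))) = X :=
    triangles_gen (X := (X : Set (Finset ℕ))) hX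
  have hcK : IsTriangle (gen (X : Set (Finset ℕ))) c := by
    have := core_iterate_subset _ _ hc
    rw [← htri] at this
    exact this
  refine gen_mem_forbidden hX hr ⟨c, hcK⟩ (fun t => ?_) fun hne => ⟨hc, fun h => ?_⟩
  -- The `k`-ball `B` around `c` already keeps `c` alive for `k` steps, so minimality gives `X ⊆ B`.
  · set B : Finset (Finset ℕ) := X.filter fun u => ∃ hu : IsTriangle (gen (X : Set (Finset ℕ))) u,
      (dualGraph (gen (X : Set (Finset ℕ)))).edist ⟨c, hcK⟩ ⟨u, hu⟩ ≤ (k : ℕ∞) with hBdef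
    have hB : (core^[k] (B : Set (Finset ℕ))).Nonempty := by
      refine ⟨c, mem_core_iterate_of_ball_subset k ⟨c, hcK⟩ (by rwa [htri]) fun u hu => ?_⟩
      have huX : u.1 ∈ triangles (gen (X : Set (Finset ℕ))) := u.2
      rw [htri] at huX
      exact Finset.mem_coe.2 (Finset.mem_filter.2 ⟨huX, u.2, hu⟩)
    have hXB : X ≤ B := hmin.le_of_le hB (Finset.filter_subset _ _)
    have htX : t.1 ∈ triangles (gen (X : Set (Finset ℕ))) := t.2
    rw [htri] at htX
    obtain ⟨-, _, h⟩ := Finset.mem_filter.1 (hXB htX)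
    exact h
  -- If `c` survived `k + 1` steps, then `core X` would itself survive `k` steps; minimality forces
  -- `core X = X`, contrary to `hne`.
  · rw [Function.iterate_succ_apply] at h
    have hfin : (core (X : Set (Finset ℕ))).Finite := X.finite_toSet.subset (core_subset _)
    have hle := hmin.le_of_le (y := hfin.toFinset) (by rw [hfin.coe_toFinset]; exact ⟨c, h⟩)
      (fun t ht => core_subset _ (hfin.mem_toFinset.1 ht))
    exact hne ((core_subset _).antisymm fun t ht => hfin.mem_toFinset.1 (hle ht))

/-- A family contains a subfamily with at most `N` members that is dense relative to `m`. -/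
def HasDense {V : Type*} [DecidableEq V] (m : ℝ) (N : ℕ) (F : Set (Finset V)) : Prop :=
  ∃ H : Finset (Finset V), (H : Set (Finset V)) ⊆ F ∧ H.Nonempty ∧ H.card ≤ N ∧
    ((supp H).card : ℝ) ≤ m * H.card

/-- The deterministic half of (a): a minimal surviving subfamily either has degree at most `r` and
is forbidden, or contains `r + 1` triangles through one edge. -/
theorem hasDense_of_core_iterate_nonempty {k r : ℕ} (hk : 1 ≤ k) (hr : 2 ≤ r)
    {F : Finset (Finset ℕ)} (hF : ∀ t ∈ F, t.card = 3)
    (hcore : (core^[k] (F : Set (Finset ℕ))).Nonempty) :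
    HasDense (1 + 2 / ((r : ℝ) + 1)) (r + 1) (F : Set (Finset ℕ)) ∨
      HasDense (muTildeMax k r) ((3 * r) ^ k) (F : Set (Finset ℕ)) := by
  obtain ⟨X, hXF, hmin⟩ := exists_minimal_le_of_wellFoundedLT
    (fun Z : Finset (Finset ℕ) => (core^[k] (Z : Set (Finset ℕ))).Nonempty) F hcore
  by_cases hdeg : ∀ e : Finset ℕ, e.card = 2 → (X.filter (e ⊆ ·)).card ≤ r
  · have hX3 : ∀ t ∈ X, t.card = 3 := fun t ht => hF t (hXF ht)
    have hforb := gen_mem_forbidden_of_minimal hX3 hdeg hmin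
    obtain ⟨H, hHS, hne, hcard, hmu⟩ := exists_muTilde_eq_of_forbidden hforb
    rw [triangles_gen (X := (X : Set (Finset ℕ))) hX3] at hHS
    refine Or.inr ⟨H, fun t ht => hXF (hHS ht), hne, hcard, ?_⟩
    have hle := (isGreatest_muTildeMax hk hr).2 ⟨_, hforb, rfl⟩
    rw [hmu, div_le_iff₀ (by exact_mod_cast hne.card_pos)] at hle
    exact hle
  · push Not at hdeg
    obtain ⟨e, he, hlt⟩ := hdeg
    obtain ⟨H, hH, hcard⟩ := Finset.exists_subset_card_eq (Nat.succ_le_of_lt hlt)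
    refine Or.inl ⟨H, fun t ht => hXF (Finset.mem_filter.1 (hH ht)).1, ?_, hcard.le, ?_⟩
    · rw [← Finset.card_pos, hcard]
      omega
    -- Each triangle through `e` adds one vertex, so the support has at most `2 + (r + 1)` vertices,
    -- and `(r + 3)/(r + 1) = 1 + 2/(r + 1)`.
    · have hsupp : supp H ⊆ e ∪ H.biUnion (· \ e) := by
        intro v hv
        obtain ⟨t, ht, hvt⟩ := Finset.mem_biUnion.1 hv
        by_cases hve : v ∈ e
        · exact Finset.mem_union_left _ hve
        · exact Finset.mem_union_right _
            (Finset.mem_biUnion.2 ⟨t, ht, Finset.mem_sdiff.2 ⟨hvt, hve⟩⟩)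
      have h1 : (H.biUnion (· \ e)).card ≤ H.card * 1 := by
        refine Finset.card_biUnion_le_card_mul _ _ _ fun t ht => ?_
        have ht' := Finset.mem_filter.1 (hH ht)
        rw [Finset.card_sdiff_of_subset ht'.2, he, hF t (hXF ht'.1)]
      have h2 : (supp H).card ≤ r + 3 := by
        refine (Finset.card_le_card hsupp).trans ((Finset.card_union_le _ _).trans ?_)
        omega
      have h3 : ((supp H).card : ℝ) ≤ r + 3 := by exact_mod_cast h2
      have hr0 : (0 : ℝ) < r + 1 := by positivity
      rw [hcard]
      refine h3.trans (le_of_eq ?_)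
      push_cast
      field_simp
      ring

end Forbidden

/-! ### Binomial random subsets of a finite type -/

section Bernoulli

open Classical in
/-- The probability that a random subset of `ι`, containing each element independently with
probability `p`, has the property `Q`. -/
noncomputable def bern {ι : Type*} [Fintype ι] (p : ℝ) (Q : Finset ι → Prop) : ℝ :=
  ∑ F : Finset ι, if Q F then p ^ F.card * (1 - p) ^ (Fintype.card ι - F.card) else 0

variable {ι : Type*} [Fintype ι] {p : ℝ}

theorem bern_eq_sum_ite (p : ℝ) (Q : Finset ι → Prop) [DecidablePred Q] :
    bern p Q =
      ∑ F : Finset ι, if Q F then p ^ F.card * (1 - p) ^ (Fintype.card ι - F.card) else 0 := by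
  rw [bern]
  refine Finset.sum_congr rfl fun F _ => ?_
  by_cases h : Q F <;> simp [h]

theorem weight_nonneg (h0 : 0 ≤ p) (h1 : p ≤ 1) (F : Finset ι) :
    0 ≤ p ^ F.card * (1 - p) ^ (Fintype.card ι - F.card) :=
  mul_nonneg (pow_nonneg h0 _) (pow_nonneg (sub_nonneg.2 h1) _)

theorem bern_nonneg (h0 : 0 ≤ p) (h1 : p ≤ 1) (Q : Finset ι → Prop) : 0 ≤ bern p Q := by
  refine Finset.sum_nonneg fun F _ => ?_
  split_ifs
  · exact weight_nonneg h0 h1 F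
  · exact le_rfl

theorem bern_mono (h0 : 0 ≤ p) (h1 : p ≤ 1) {Q R : Finset ι → Prop} (h : ∀ F, Q F → R F) :
    bern p Q ≤ bern p R := by
  refine Finset.sum_le_sum fun F _ => ?_
  have := weight_nonneg h0 h1 F
  by_cases hQ : Q F
  · rw [if_pos hQ, if_pos (h F hQ)]
  · rw [if_neg hQ]
    split_ifs
    · exact this
    · exact le_rfl

theorem bern_or_le (h0 : 0 ≤ p) (h1 : p ≤ 1) (Q R : Finset ι → Prop) :
    bern p (fun F => Q F ∨ R F) ≤ bern p Q + bern p R := by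
  rw [bern, bern, bern, ← Finset.sum_add_distrib]
  refine Finset.sum_le_sum fun F _ => ?_
  have := weight_nonneg h0 h1 F
  by_cases hQ : Q F <;> by_cases hR : R F <;> simp [hQ, hR, this]

theorem bern_add_bern_not (p : ℝ) (Q : Finset ι → Prop) :
    bern p Q + bern p (fun F => ¬ Q F) = 1 := by
  rw [bern, bern, ← Finset.sum_add_distrib]
  have h := Fintype.sum_pow_mul_eq_add_pow ι p (1 - p)
  rw [add_sub_cancel, one_pow] at h
  refine Eq.trans (Finset.sum_congr rfl fun F _ => ?_) h
  by_cases hQ : Q F <;> simp [hQ]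

/-- Writing `F = H ∪ G` with `G ⊆ Hᶜ` factors out `p ^ H.card`; the weights of `G` sum to 1 by the
binomial theorem. -/
theorem bern_superset (p : ℝ) (H : Finset ι) : bern p (fun F => H ⊆ F) = p ^ H.card := by
  classical
  have hkey := Finset.sum_pow_mul_eq_add_pow p (1 - p) Hᶜ
  rw [add_sub_cancel, one_pow] at hkey
  rw [bern_eq_sum_ite, ← Finset.sum_filter]
  have hmul : p ^ H.card = p ^ H.card *
      ∑ t ∈ Hᶜ.powerset, p ^ t.card * (1 - p) ^ (Hᶜ.card - t.card) := by rw [hkey, mul_one]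
  rw [hmul, Finset.mul_sum]
  symm
  refine Finset.sum_bij (fun G _ => H ∪ G) ?_ ?_ ?_ ?_
  · intro G _
    simp
  · intro G hG G' hG' h
    have hd : ∀ K ∈ Hᶜ.powerset, (H ∪ K) \ H = K := fun K hK => by
      rw [Finset.union_sdiff_left, Finset.sdiff_eq_self_iff_disjoint]
      exact (Finset.subset_compl_iff_disjoint_right).1 (Finset.mem_powerset.1 hK)
    rw [← hd G hG, ← hd G' hG', h]
  · intro F hF
    refine ⟨F \ H, ?_, Finset.union_sdiff_of_subset (Finset.mem_filter.1 hF).2⟩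
    rw [Finset.mem_powerset]
    intro x hx
    exact Finset.mem_compl.2 (Finset.mem_sdiff.1 hx).2
  · intro G hG
    have hdisj : Disjoint H G :=
      ((Finset.subset_compl_iff_disjoint_right).1 (Finset.mem_powerset.1 hG)).symm
    rw [Finset.card_union_of_disjoint hdisj, Finset.card_compl, pow_add, mul_assoc, Nat.sub_sub]

/-- First moment bound. -/
theorem bern_le_sum (h0 : 0 ≤ p) (h1 : p ≤ 1) {Q : Finset ι → Prop} (A : Finset (Finset ι))
    (h : ∀ F, Q F → ∃ H ∈ A, H ⊆ F) : bern p Q ≤ ∑ H ∈ A, p ^ H.card := by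
  classical
  simp_rw [← bern_superset, bern_eq_sum_ite]
  rw [Finset.sum_comm]
  refine Finset.sum_le_sum fun F _ => ?_
  have hw := weight_nonneg h0 h1 F
  have hnn : ∀ H ∈ A, 0 ≤ if H ⊆ F then
      p ^ F.card * (1 - p) ^ (Fintype.card ι - F.card) else 0 := by
    intro H _
    split_ifs
    · exact hw
    · exact le_rfl
  by_cases hQ : Q F
  · obtain ⟨H, hH, hHF⟩ := h F hQ
    rw [if_pos hQ]
    refine le_trans (le_of_eq ?_) (Finset.single_le_sum hnn hH)
    simp only [if_pos hHF]
  · rw [if_neg hQ]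
    exact Finset.sum_nonneg hnn

/-- Second moment bound. -/
theorem bern_forall_not_subset_mul_le [DecidableEq ι] (h0 : 0 ≤ p) (h1 : p ≤ 1) {J : Type*}
    [Fintype J] (T : J → Finset ι) (f : ℕ) (hT : ∀ j, (T j).card = f) :
    bern p (fun F => ∀ j, ¬ T j ⊆ F) * ((Fintype.card J : ℝ) * p ^ f) ^ 2 ≤
      ∑ i, ∑ j, p ^ (T i ∪ T j).card - ((Fintype.card J : ℝ) * p ^ f) ^ 2 := by
  classical
  set E : ℝ := (Fintype.card J : ℝ) * p ^ f with hE
  set w : Finset ι → ℝ := fun F => p ^ F.card * (1 - p) ^ (Fintype.card ι - F.card) with hw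
  set X : Finset ι → ℝ := fun F => ∑ j, if T j ⊆ F then 1 else 0 with hX
  have hsup : ∀ H : Finset ι, ∑ F, w F * (if H ⊆ F then 1 else 0) = p ^ H.card := fun H => by
    rw [← bern_superset, bern_eq_sum_ite]
    exact Finset.sum_congr rfl fun F _ => by simp [hw]
  have hw1 : ∑ F, w F = 1 := by simpa using hsup ∅
  have hX1 : ∑ F, w F * X F = E := by
    simp only [hX, Finset.mul_sum]
    rw [Finset.sum_comm]
    simp only [hsup, hT]
    simp [hE]
  have hX2 : ∑ F, w F * X F ^ 2 = ∑ i, ∑ j, p ^ (T i ∪ T j).card := by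
    have : ∀ F, w F * X F ^ 2 = ∑ i, ∑ j, w F * (if T i ∪ T j ⊆ F then 1 else 0) := by
      intro F
      simp only [hX]
      rw [sq, Finset.sum_mul_sum, Finset.mul_sum]
      simp only [Finset.mul_sum]
      refine Finset.sum_congr rfl fun i _ => Finset.sum_congr rfl fun j _ => ?_
      by_cases hi : T i ⊆ F <;> by_cases hj : T j ⊆ F <;> simp [Finset.union_subset_iff, hi, hj]
    simp only [this]
    rw [Finset.sum_comm]
    refine Finset.sum_congr rfl fun i _ => ?_
    rw [Finset.sum_comm]
    exact Finset.sum_congr rfl fun j _ => hsup _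
  -- Chebyshev's argument: `X` counts the `T j` inside `F` and has mean `E`, and every `F` with `X F
  -- = 0` contributes `w F * E ^ 2` to the variance.
  have hvar : ∑ F, w F * (X F - E) ^ 2 = ∑ i, ∑ j, p ^ (T i ∪ T j).card - E ^ 2 := by
    have : ∀ F, w F * (X F - E) ^ 2 = w F * X F ^ 2 - 2 * E * (w F * X F) + E ^ 2 * w F :=
      fun F => by ring
    simp only [this]
    rw [Finset.sum_add_distrib, Finset.sum_sub_distrib, ← Finset.mul_sum, ← Finset.mul_sum,
      hX1, hX2, hw1]
    ring
  rw [← hvar, bern, Finset.sum_mul]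
  refine Finset.sum_le_sum fun F _ => ?_
  have hwF : 0 ≤ w F := weight_nonneg h0 h1 F
  split_ifs with h
  · have : X F = 0 := Finset.sum_eq_zero fun j _ => if_neg (h j)
    rw [this, zero_sub, neg_sq]
  · rw [zero_mul]
    exact mul_nonneg hwF (sq_nonneg _)

end Bernoulli

/-! ### Random families of 3-sets -/

section Random

/-- The 3-subsets of `Fin n`. -/
abbrev Triple (n : ℕ) := {t : Finset (Fin n) // t.card = 3}

/-- The family of finite sets underlying a family of triples. -/
def sets {n : ℕ} (F : Finset (Triple n)) : Finset (Finset (Fin n)) :=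
  F.map (Function.Embedding.subtype _)

theorem mem_sets {n : ℕ} {F : Finset (Triple n)} {t : Finset (Fin n)} :
    t ∈ sets F ↔ ∃ h : t.card = 3, (⟨t, h⟩ : Triple n) ∈ F := by
  simp [sets]

theorem card_of_mem_sets {n : ℕ} {F : Finset (Triple n)} {t : Finset (Fin n)}
    (h : t ∈ sets F) : t.card = 3 := (mem_sets.1 h).1

theorem card_sets {n : ℕ} (F : Finset (Triple n)) : (sets F).card = F.card :=
  Finset.card_map _

theorem sets_subset_sets {n : ℕ} {F G : Finset (Triple n)} : sets F ⊆ sets G ↔ F ⊆ G :=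
  Finset.map_subset_map

theorem exists_sets_eq {n : ℕ} {H : Finset (Finset (Fin n))} (hH : ∀ t ∈ H, t.card = 3) :
    ∃ G : Finset (Triple n), sets G = H := by
  refine ⟨H.subtype fun t => t.card = 3, ?_⟩
  ext t
  simp only [mem_sets, Finset.mem_subtype, exists_prop]
  exact ⟨fun h => h.2, fun h => ⟨hH t h, h⟩⟩

theorem triangles_ofTriangles {n : ℕ} (F : Finset (Triple n)) :
    triangles (ofTriangles F) = sets F := by
  ext t
  rw [Finset.mem_coe, mem_sets]
  constructor
  · rintro ⟨⟨-, h | ⟨u, hu, rfl⟩⟩, hc⟩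
    · omega
    · exact ⟨hc, hu⟩
  · rintro ⟨hc, ht⟩
    exact ⟨⟨Finset.card_pos.1 (by omega), Or.inr ⟨_, ht, rfl⟩⟩, hc⟩

theorem dimLE_ofTriangles {n : ℕ} (F : Finset (Triple n)) : DimLE (ofTriangles F) 2 := by
  rintro s ⟨-, h | ⟨u, -, rfl⟩⟩
  · omega
  · exact u.2.le

theorem prob_eq_bern (n : ℕ) (p : ℝ) (Q : Complex (Fin n) → Prop) :
    prob n p Q = bern p (fun F : Finset (Triple n) => Q (ofTriangles F)) := by
  have : Fintype.card (Triple n) = n.choose 3 := by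
    rw [Fintype.card_finset_len, Fintype.card_fin]
  simp only [prob, bern, this]

/-- There are at most `n ^ v` supports `A`, and at most `2 ^ v` triples inside each, hence at most
`2 ^ 2 ^ v` families. -/
theorem card_filter_card_supp_le (n v : ℕ) :
    (Finset.univ.filter fun H : Finset (Triple n) => (supp (sets H)).card = v).card ≤
      n ^ v * 2 ^ 2 ^ v := by
  have hsub : (Finset.univ.filter fun H : Finset (Triple n) => (supp (sets H)).card = v) ⊆
      ((Finset.univ : Finset (Fin n)).powersetCard v).biUnion fun A =>
        (Finset.univ.filter fun t : Triple n => t.1 ⊆ A).powerset := by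
    intro H hH
    refine Finset.mem_biUnion.2 ⟨supp (sets H), Finset.mem_powersetCard.2
      ⟨Finset.subset_univ _, (Finset.mem_filter.1 hH).2⟩, Finset.mem_powerset.2 fun t ht => ?_⟩
    exact Finset.mem_filter.2 ⟨Finset.mem_univ _, subset_supp (mem_sets.2 ⟨t.2, ht⟩)⟩
  refine (Finset.card_le_card hsub).trans ((Finset.card_biUnion_le_card_mul _ _ (2 ^ 2 ^ v)
    fun A hA => ?_).trans (Nat.mul_le_mul_right _ ?_))
  · rw [Finset.card_powerset]
    refine Nat.pow_le_pow_right two_pos ?_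
    rw [← (Finset.mem_powersetCard.1 hA).2, ← Finset.card_powerset,
      ← Finset.card_map (Function.Embedding.subtype _)]
    refine Finset.card_le_card fun s hs => ?_
    obtain ⟨t, ht, rfl⟩ := Finset.mem_map.1 hs
    exact Finset.mem_powerset.2 (Finset.mem_filter.1 ht).2
  · rw [Finset.card_powersetCard, Finset.card_univ, Fintype.card_fin]
    exact Nat.choose_le_pow n v

/-- With `ε = p * n ^ m ≤ 1`, the density bound gives `p ^ f * n ^ v ≤ ε ^ f ≤ ε`. -/
theorem pow_le_of_card_le {n v f : ℕ} {p m : ℝ} (hn : 1 ≤ n) (h0 : 0 ≤ p) (hf : 1 ≤ f)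
    (hv : (v : ℝ) ≤ m * f) (hp : p / (n : ℝ) ^ (-m) ≤ 1) :
    p ^ f ≤ p / (n : ℝ) ^ (-m) * ((n : ℝ) ^ v)⁻¹ := by
  have hn0 : (0 : ℝ) < n := by exact_mod_cast hn
  have hn1 : (1 : ℝ) ≤ n := by exact_mod_cast hn
  have hε : 0 ≤ p / (n : ℝ) ^ (-m) := by positivity
  rw [← div_eq_mul_inv, le_div_iff₀ (by positivity)]
  calc p ^ f * (n : ℝ) ^ v ≤ p ^ f * ((n : ℝ) ^ m) ^ f := by
        gcongr
        rw [← Real.rpow_natCast, ← Real.rpow_natCast, ← Real.rpow_mul hn0.le]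
        exact Real.rpow_le_rpow_of_exponent_le hn1 hv
    _ = (p / (n : ℝ) ^ (-m)) ^ f := by
        rw [Real.rpow_neg hn0.le, div_inv_eq_mul, mul_pow]
    _ ≤ p / (n : ℝ) ^ (-m) := pow_le_of_le_one hε hp (by omega)

theorem bern_hasDense_le {n N : ℕ} {p m : ℝ} (hn : 1 ≤ n) (h0 : 0 ≤ p) (h1 : p ≤ 1)
    (hp : p / (n : ℝ) ^ (-m) ≤ 1) :
    bern p (fun F : Finset (Triple n) => HasDense m N (sets F : Set (Finset (Fin n)))) ≤
      p / (n : ℝ) ^ (-m) * ∑ v ∈ Finset.range (3 * N + 1), (2 : ℝ) ^ 2 ^ v := by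
  classical
  have hn0 : (0 : ℝ) < n := by exact_mod_cast hn
  set A : Finset (Finset (Triple n)) := Finset.univ.filter fun H =>
    H.Nonempty ∧ H.card ≤ N ∧ ((supp (sets H)).card : ℝ) ≤ m * H.card with hA
  refine (bern_le_sum h0 h1 A ?_).trans ?_
  · rintro F ⟨H, hHF, hne, hcard, hsupp⟩
    obtain ⟨G, rfl⟩ := exists_sets_eq fun t ht => card_of_mem_sets (hHF ht)
    rw [card_sets] at hcard hsupp
    refine ⟨G, Finset.mem_filter.2 ⟨Finset.mem_univ _, ?_, hcard, hsupp⟩,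
      sets_subset_sets.1 (Finset.coe_subset.1 hHF)⟩
    rwa [← Finset.card_pos, ← card_sets, Finset.card_pos]
  · calc ∑ H ∈ A, p ^ H.card
        ≤ ∑ H ∈ A, p / (n : ℝ) ^ (-m) * ((n : ℝ) ^ (supp (sets H)).card)⁻¹ := by
          refine Finset.sum_le_sum fun H hH => ?_
          obtain ⟨-, hne, -, hsupp⟩ := Finset.mem_filter.1 hH
          exact pow_le_of_card_le hn h0 hne.card_pos hsupp hp
      -- Grouping by support size, at most `3N`, lets the number of families with that support size
      -- cancel the factor `n ^ (-v)`.
      _ = p / (n : ℝ) ^ (-m) * ∑ v ∈ Finset.range (3 * N + 1),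
            ∑ H ∈ A with (supp (sets H)).card = v, ((n : ℝ) ^ (supp (sets H)).card)⁻¹ := by
          rw [← Finset.mul_sum, Finset.sum_fiberwise_of_maps_to]
          intro H hH
          obtain ⟨-, -, hcard, -⟩ := Finset.mem_filter.1 hH
          have := card_supp_le (X := sets H) fun t ht => card_of_mem_sets ht
          rw [card_sets] at this
          rw [Finset.mem_range]
          omega
      _ ≤ _ := by
          refine mul_le_mul_of_nonneg_left (Finset.sum_le_sum fun v _ => ?_) (by positivity)
          have hle : ((A.filter fun H => (supp (sets H)).card = v).card : ℝ) ≤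
              (n : ℝ) ^ v * 2 ^ 2 ^ v := by
            exact_mod_cast (Finset.card_le_card (Finset.filter_subset_filter _
              (Finset.subset_univ A))).trans (card_filter_card_supp_le n v)
          rw [Finset.sum_congr rfl (g := fun _ => ((n : ℝ) ^ v)⁻¹) fun H hH => by
            rw [(Finset.mem_filter.1 hH).2], Finset.sum_const, nsmul_eq_mul,
            ← div_eq_mul_inv, div_le_iff₀ (by positivity), mul_comm]
          rwa [mul_comm] at hle ⊢

/-- Sparse random families have no dense bounded subfamilies. -/
theorem tendsto_bern_hasDense {p : ℕ → ℝ} (hp : ∀ n, 0 < p n ∧ p n < 1) {m : ℝ} (N : ℕ)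
    (h : MuchLess p (fun n => (n : ℝ) ^ (-m))) :
    Tendsto (fun n => bern (p n) (fun F : Finset (Triple n) =>
      HasDense m N (sets F : Set (Finset (Fin n))))) atTop (𝓝 0) := by
  have hlim := h.2.mul_const (∑ v ∈ Finset.range (3 * N + 1), (2 : ℝ) ^ 2 ^ v)
  rw [zero_mul] at hlim
  refine tendsto_of_tendsto_of_tendsto_of_le_of_le' tendsto_const_nhds hlim
    (Eventually.of_forall fun n => bern_nonneg (hp n).1.le (hp n).2.le _) ?_
  filter_upwards [h.2.eventually_le_const zero_lt_one, eventually_ge_atTop 1] with n hn h1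
  exact bern_hasDense_le h1 (hp n).1.le (hp n).2.le hn

theorem HasDense.of_image {V W : Type*} [DecidableEq V] [DecidableEq W] {m : ℝ} {N : ℕ}
    (g : V ↪ W) {F : Set (Finset V)} (h : HasDense m N (Finset.map g '' F)) :
    HasDense m N F := by
  obtain ⟨H, hHF, hne, hcard, hsupp⟩ := h
  obtain ⟨H', hH', rfl⟩ := Finset.subset_set_image_iff.1 hHF
  have hc : (H'.image (Finset.map g)).card = H'.card :=
    Finset.card_image_of_injective _ (Finset.map_injective g)
  have hs : supp (H'.image (Finset.map g)) = (supp H').map g := by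
    ext w
    simp only [supp, Finset.mem_biUnion, Finset.mem_image, Finset.mem_map, id]
    constructor
    · rintro ⟨_, ⟨t, ht, rfl⟩, hw⟩
      obtain ⟨v, hv, rfl⟩ := Finset.mem_map.1 hw
      exact ⟨v, ⟨t, ht, hv⟩, rfl⟩
    · rintro ⟨v, ⟨t, ht, hv⟩, rfl⟩
      exact ⟨_, ⟨t, ht, rfl⟩, Finset.mem_map_of_mem g hv⟩
  rw [hc] at hcard hsupp
  rw [hs, Finset.card_map] at hsupp
  exact ⟨H', hH', Finset.image_nonempty.1 hne, hcard, hsupp⟩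

end Random

/-! ### Containment of a fixed family -/

section Containment

/-- The map on triples induced by an injection. -/
def mapTriple {M n : ℕ} (g : Fin M ↪ Fin n) : Triple M ↪ Triple n where
  toFun t := ⟨t.1.map g, by rw [Finset.card_map, t.2]⟩
  inj' s t h := Subtype.ext (Finset.map_injective g (congrArg Subtype.val h))

theorem sets_map {M n : ℕ} (g : Fin M ↪ Fin n) (T : Finset (Triple M)) :
    (sets (T.map (mapTriple g)) : Set (Finset (Fin n))) =
      Finset.map g '' (sets T : Set (Finset (Fin M))) := by
  ext s
  simp only [sets, Finset.coe_map, Set.mem_image, Finset.mem_coe]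
  constructor
  · rintro ⟨_, ⟨t, ht, rfl⟩, rfl⟩
    exact ⟨_, ⟨t, ht, rfl⟩, rfl⟩
  · rintro ⟨_, ⟨t, ht, rfl⟩, rfl⟩
    exact ⟨_, ⟨t, ht, rfl⟩, rfl⟩

/-- Injectivity is dropped: each vertex of `U` has `B.card` possible images, every other vertex has
`n`. -/
theorem card_embedding_mapsTo_le {M n : ℕ} (U : Finset (Fin M)) (B : Finset (Fin n)) :
    (Finset.univ.filter fun g : Fin M ↪ Fin n => ∀ v ∈ U, g v ∈ B).card ≤
      B.card ^ U.card * n ^ (M - U.card) := by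
  classical
  have hpi : (Fintype.piFinset fun v : Fin M => if v ∈ U then B else Finset.univ).card =
      B.card ^ U.card * n ^ (M - U.card) := by
    rw [Fintype.card_piFinset]
    have : ∀ v : Fin M, (if v ∈ U then B else Finset.univ).card = if v ∈ U then B.card else n := by
      intro v
      split_ifs <;> simp
    simp only [this]
    rw [Finset.prod_ite, Finset.prod_const, Finset.prod_const, Finset.filter_mem_eq_inter,
      Finset.univ_inter, Finset.filter_not, Finset.filter_mem_eq_inter, Finset.univ_inter,
      ← Finset.compl_eq_univ_sdiff, Finset.card_compl, Fintype.card_fin]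
  rw [← hpi]
  refine Finset.card_le_card_of_injOn (fun g => (g : Fin M → Fin n)) (fun g hg => ?_)
    DFunLike.coe_injective.injOn
  rw [Finset.mem_coe, Fintype.mem_piFinset]
  intro v
  split_ifs with hv
  · exact (Finset.mem_filter.1 hg).2 v hv
  · exact Finset.mem_univ _

/-- The placements `g` are sorted by the part `H` of `T` that `g` maps into the copy given by `h`.
The empty overlap gives the first term; otherwise `g` sends the support of `H` into the `M` vertices
in the range of `h`. -/
theorem card_union_map_sum_le {M n : ℕ} {p : ℝ} (h0 : 0 < p) (T : Finset (Triple M))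
    (h : Fin M ↪ Fin n) :
    ∑ g : Fin M ↪ Fin n, p ^ (T.map (mapTriple g) ∪ T.map (mapTriple h)).card ≤
      p ^ (2 * T.card) * Fintype.card (Fin M ↪ Fin n) +
      p ^ (2 * T.card) * ∑ H ∈ T.powerset.erase ∅,
        (M : ℝ) ^ (supp (sets H)).card * (n : ℝ) ^ (M - (supp (sets H)).card) *
          (p ^ H.card)⁻¹ := by
  classical
  set D : (Fin M ↪ Fin n) → Finset (Triple M) := fun g =>
    T.filter fun t => mapTriple g t ∈ T.map (mapTriple h) with hD
  have hterm : ∀ g, p ^ (T.map (mapTriple g) ∪ T.map (mapTriple h)).card =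
      p ^ (2 * T.card) * (p ^ (D g).card)⁻¹ := by
    intro g
    have hinter : T.map (mapTriple g) ∩ T.map (mapTriple h) = (D g).map (mapTriple g) := by
      ext s
      simp only [hD, Finset.mem_inter, Finset.mem_map, Finset.mem_filter]
      constructor
      · rintro ⟨⟨t, ht, rfl⟩, h'⟩
        exact ⟨t, ⟨ht, h'⟩, rfl⟩
      · rintro ⟨t, ⟨ht, h'⟩, rfl⟩
        exact ⟨⟨t, ht, rfl⟩, h'⟩
    have hcard := Finset.card_union_add_card_inter (T.map (mapTriple g)) (T.map (mapTriple h))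
    rw [hinter, Finset.card_map, Finset.card_map, Finset.card_map, ← two_mul] at hcard
    rw [← hcard, pow_add, mul_assoc, mul_inv_cancel₀ (by positivity), mul_one]
  have hcount : ∀ H, ((Finset.univ.filter fun g => D g = H).card : ℝ) ≤
      (M : ℝ) ^ (supp (sets H)).card * (n : ℝ) ^ (M - (supp (sets H)).card) := by
    intro H
    have := card_embedding_mapsTo_le (supp (sets H)) (Finset.univ.map h)
    rw [Finset.card_map, Finset.card_univ, Fintype.card_fin] at this
    suffices hsub : (Finset.univ.filter fun g => D g = H) ⊆ Finset.univ.filter fun g : Fin M ↪ Fin n =>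
        ∀ v ∈ supp (sets H), g v ∈ Finset.univ.map h by
      exact_mod_cast (Finset.card_le_card hsub).trans this
    intro g hg
    have hg := (Finset.mem_filter.1 hg).2
    refine Finset.mem_filter.2 ⟨Finset.mem_univ _, fun v hv => ?_⟩
    obtain ⟨t, ht, hvt⟩ := Finset.mem_biUnion.1 hv
    obtain ⟨h3, ht⟩ := mem_sets.1 ht
    rw [← hg] at ht
    obtain ⟨t', -, htt'⟩ := Finset.mem_map.1 (Finset.mem_filter.1 ht).2
    have hgv : g v ∈ t.map g := Finset.mem_map_of_mem g hvt
    have heq : t'.1.map h = t.map g := congrArg Subtype.val htt'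
    rw [← heq] at hgv
    obtain ⟨w, -, hw⟩ := Finset.mem_map.1 hgv
    exact Finset.mem_map.2 ⟨w, Finset.mem_univ _, hw⟩
  have hmaps : ∀ g ∈ Finset.univ, D g ∈ T.powerset := fun g _ =>
    Finset.mem_powerset.2 (Finset.filter_subset _ _)
  simp only [hterm]
  rw [← Finset.mul_sum, ← mul_add]
  refine mul_le_mul_of_nonneg_left ?_ (by positivity)
  rw [← Finset.sum_fiberwise_of_maps_to hmaps, ← Finset.add_sum_erase _ _
    (Finset.empty_mem_powerset T)]
  refine add_le_add ?_ (Finset.sum_le_sum fun H _ => ?_)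
  · rw [Finset.sum_congr rfl (g := fun _ => (1 : ℝ)) fun g hg => by
      rw [(Finset.mem_filter.1 hg).2]; simp, Finset.sum_const, nsmul_eq_mul, mul_one]
    exact Nat.cast_le.2 (Finset.card_le_univ _)
  · rw [Finset.sum_congr rfl (g := fun _ => (p ^ H.card)⁻¹) fun g hg => by
      rw [(Finset.mem_filter.1 hg).2], Finset.sum_const, nsmul_eq_mul]
    exact mul_le_mul_of_nonneg_right (hcount H) (by positivity)

/-- Every factor of the descending factorial is at least `n + 1 - M`, which exceeds `n / 2`. -/
theorem pow_le_two_pow_mul_card_embedding {M n : ℕ} (h : 2 * M ≤ n) :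
    (n : ℝ) ^ M ≤ 2 ^ M * Fintype.card (Fin M ↪ Fin n) := by
  rw [Fintype.card_embedding_eq, Fintype.card_fin, Fintype.card_fin]
  have h1 : n ^ M ≤ 2 ^ M * n.descFactorial M := by
    refine le_trans ?_ (Nat.mul_le_mul_left _ (Nat.pow_sub_le_descFactorial n M))
    rw [← mul_pow]
    exact Nat.pow_le_pow_left (by omega) M
  exact_mod_cast h1

theorem bern_forall_not_map_subset_le {M n : ℕ} {p m : ℝ} (hM : 1 ≤ M) (hn : 2 * M ≤ n)
    (h0 : 0 < p) (h1 : p ≤ 1) (hp : (n : ℝ) ^ (-m) / p ≤ 1) (T : Finset (Triple M))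
    (hT : ∀ H ⊆ T, H.Nonempty → m * H.card ≤ (supp (sets H)).card) :
    bern p (fun F : Finset (Triple n) => ∀ g : Fin M ↪ Fin n, ¬ T.map (mapTriple g) ⊆ F) ≤
      2 ^ T.card * (2 ^ M * (M : ℝ) ^ M) * ((n : ℝ) ^ (-m) / p) := by
  classical
  have hn1 : (1 : ℝ) ≤ n := by exact_mod_cast (by omega : 1 ≤ n)
  have hn0 : (0 : ℝ) < n := by linarith
  have hM1 : (1 : ℝ) ≤ M := by exact_mod_cast hM
  set ε := (n : ℝ) ^ (-m) / p with hε
  have hε0 : 0 ≤ ε := by positivity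
  have hJ := pow_le_two_pow_mul_card_embedding hn
  set J : ℝ := (Fintype.card (Fin M ↪ Fin n) : ℝ) with hJdef
  have hJ0 : 0 < J := by
    by_contra! hcon
    have : (0 : ℝ) < (n : ℝ) ^ M := by positivity
    have : 2 ^ M * J ≤ 0 := mul_nonpos_of_nonneg_of_nonpos (by positivity) hcon
    linarith
  have hsecond := bern_forall_not_subset_mul_le h0.le h1
    (fun g : Fin M ↪ Fin n => T.map (mapTriple g)) T.card fun g => Finset.card_map _
  rw [← hJdef] at hsecond
  have hterm : ∀ H ∈ T.powerset.erase ∅,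
      (M : ℝ) ^ (supp (sets H)).card * (n : ℝ) ^ (M - (supp (sets H)).card) * (p ^ H.card)⁻¹ ≤
        2 ^ M * (M : ℝ) ^ M * ε * J := by
    intro H hH
    obtain ⟨hne, hHT⟩ := Finset.mem_erase.1 hH
    have hne' := Finset.nonempty_iff_ne_empty.2 hne
    have hu : (supp (sets H)).card ≤ M := by
      simpa using Finset.card_le_univ (supp (sets H))
    have hden := hT H (Finset.mem_powerset.1 hHT) hne'
    set u := (supp (sets H)).card with hudef
    -- The reciprocal of the order of the expected number of copies of `H`; the sparsity of `T`
    -- bounds it by `ε ^ H.card`.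
    have hpow : ((n : ℝ) ^ u)⁻¹ * (p ^ H.card)⁻¹ ≤ ε := by
      calc ((n : ℝ) ^ u)⁻¹ * (p ^ H.card)⁻¹ ≤ ((n : ℝ) ^ (-m)) ^ H.card * (p ^ H.card)⁻¹ := by
            refine mul_le_mul_of_nonneg_right ?_ (by positivity)
            rw [← Real.rpow_natCast, ← Real.rpow_natCast, ← Real.rpow_mul hn0.le,
              ← Real.rpow_neg hn0.le]
            exact Real.rpow_le_rpow_of_exponent_le hn1 (by linarith)
        _ = ε ^ H.card := by rw [hε, div_pow, div_eq_mul_inv]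
        _ ≤ ε := pow_le_of_le_one hε0 hp hne'.card_pos.ne'
    calc (M : ℝ) ^ u * (n : ℝ) ^ (M - u) * (p ^ H.card)⁻¹
        = (M : ℝ) ^ u * (n : ℝ) ^ M * (((n : ℝ) ^ u)⁻¹ * (p ^ H.card)⁻¹) := by
          rw [pow_sub₀ _ hn0.ne' hu]
          ring
      _ ≤ (M : ℝ) ^ M * (2 ^ M * J) * ε := by
          gcongr
      _ = 2 ^ M * (M : ℝ) ^ M * ε * J := by ring
  have hsum : ∑ H ∈ T.powerset.erase ∅, (M : ℝ) ^ (supp (sets H)).card *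
      (n : ℝ) ^ (M - (supp (sets H)).card) * (p ^ H.card)⁻¹ ≤
        2 ^ T.card * (2 ^ M * (M : ℝ) ^ M * ε * J) := by
    refine (Finset.sum_le_card_nsmul _ _ _ hterm).trans ?_
    rw [nsmul_eq_mul]
    refine mul_le_mul_of_nonneg_right ?_ (by positivity)
    have : (T.powerset.erase ∅).card ≤ 2 ^ T.card :=
      (Finset.card_erase_le).trans (Finset.card_powerset T).le
    exact_mod_cast this
  have hdouble : ∑ i : Fin M ↪ Fin n, ∑ j : Fin M ↪ Fin n,
      p ^ (T.map (mapTriple i) ∪ T.map (mapTriple j)).card ≤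
        J * (p ^ (2 * T.card) * J +
          p ^ (2 * T.card) * (2 ^ T.card * (2 ^ M * (M : ℝ) ^ M * ε * J))) := by
    rw [Finset.sum_comm]
    refine (Finset.sum_le_card_nsmul Finset.univ _ _ fun h _ =>
      (card_union_map_sum_le h0 T h).trans
        (add_le_add le_rfl (mul_le_mul_of_nonneg_left hsum (by positivity)))).trans ?_
    rw [nsmul_eq_mul, Finset.card_univ]
  have hE : 0 < (J * p ^ T.card) ^ 2 := by positivity
  refine le_of_mul_le_mul_right (hsecond.trans ?_) hE
  -- The empty-overlap term is exactly the squared mean and cancels, leaving the error proportional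
  -- to `ε`.
  refine (sub_le_sub_right hdouble _).trans (le_of_eq ?_)
  ring

/-- If the expected number of copies of each nonempty subfamily tends to infinity, then copies of
the whole family exist asymptotically almost surely. -/
theorem tendsto_bern_forall_not_map_subset {p : ℕ → ℝ} (hp : ∀ n, 0 < p n ∧ p n < 1) {m : ℝ}
    (h : MuchLess (fun n => (n : ℝ) ^ (-m)) p) {M : ℕ} (hM : 1 ≤ M) (T : Finset (Triple M))
    (hT : ∀ H ⊆ T, H.Nonempty → m * H.card ≤ (supp (sets H)).card) :
    Tendsto (fun n => bern (p n) (fun F : Finset (Triple n) =>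
      ∀ g : Fin M ↪ Fin n, ¬ T.map (mapTriple g) ⊆ F)) atTop (𝓝 0) := by
  have hlim := h.2.const_mul (2 ^ T.card * (2 ^ M * (M : ℝ) ^ M))
  rw [mul_zero] at hlim
  refine tendsto_of_tendsto_of_tendsto_of_le_of_le' tendsto_const_nhds hlim
    (Eventually.of_forall fun n => bern_nonneg (hp n).1.le (hp n).2.le _) ?_
  filter_upwards [h.2.eventually_le_const zero_lt_one, eventually_ge_atTop (2 * M)] with n hn h1
  exact bern_forall_not_map_subset_le hM h1 (hp n).1 (hp n).2.le hn T hT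

end Containment

/-! ### The threshold -/

section Threshold

variable {k r : ℕ}

theorem hasDense_of_not_collapsible (hk : 1 ≤ k) (hr : 2 ≤ r) {n : ℕ} (F : Finset (Triple n))
    (h : ¬ CollapsibleToGraph k (ofTriangles F)) :
    HasDense (1 + 2 / ((r : ℝ) + 1)) (r + 1) (sets F : Set (Finset (Fin n))) ∨
      HasDense (muTildeMax k r) ((3 * r) ^ k) (sets F : Set (Finset (Fin n))) := by
  rw [collapsibleToGraph_iff (dimLE_ofTriangles F), triangles_ofTriangles, ← ne_eq,
    ← Set.nonempty_iff_ne_empty] at h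
  have himg : (((sets F).image (Finset.map Fin.valEmbedding) : Finset (Finset ℕ)) :
      Set (Finset ℕ)) = Finset.map Fin.valEmbedding '' (sets F : Set (Finset (Fin n))) :=
    Finset.coe_image
  have := hasDense_of_core_iterate_nonempty hk hr
    (F := (sets F).image (Finset.map Fin.valEmbedding)) (fun s hs => ?_) ?_
  · rw [himg] at this
    exact this.imp (HasDense.of_image _) (HasDense.of_image _)
  · obtain ⟨t, ht, rfl⟩ := Finset.mem_image.1 hs
    rw [Finset.card_map, card_of_mem_sets ht]
  · rw [himg, core_iterate_image]
    exact h.image _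

/-- A forbidden complex realised by a family of triples. -/
theorem exists_triples_of_forbidden (hk : 1 ≤ k) {S : Complex ℕ} (hS : S ∈ forbidden k r) :
    ∃ (M : ℕ) (T : Finset (Triple M)), 1 ≤ M ∧
      (core^[k] (sets T : Set (Finset (Fin M)))).Nonempty ∧
      ∀ H ⊆ T, H.Nonempty → muTilde S * H.card ≤ (supp (sets H)).card := by
  classical
  obtain ⟨hS, c, hc, -⟩ := hS
  have hcore : (core^[k] (triangles S)).Nonempty := by
    by_cases hcl : IsClosedComplex S
    · rw [core_iterate_of_core_eq (isClosedComplex_iff.1 hcl)]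
      exact ⟨c.1, c.2⟩
    · exact ⟨c.1, mem_core_of_collapseTime_eq hk c.2 (hc hcl)⟩
  have hfin : (triangles S).Finite := hS.finite.subset fun t ht => ht.1
  obtain ⟨M, hM⟩ : ∃ M, ∀ t ∈ triangles S, ∀ v ∈ t, v < M := by
    refine ⟨(supp hfin.toFinset).sup id + 1, fun t ht v hv => Nat.lt_succ_of_le ?_⟩
    exact Finset.le_sup (f := id) (subset_supp (hfin.mem_toFinset.2 ht) hv)
  have hM1 : 1 ≤ M := by
    obtain ⟨v, hv⟩ := Finset.card_pos.1 (show 0 < c.1.card by rw [c.2.2]; norm_num)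
    exact Nat.one_le_of_lt (hM c.1 c.2 v hv)
  set T : Finset (Triple M) :=
    Finset.univ.filter fun t => t.1.map Fin.valEmbedding ∈ triangles S with hTdef
  have himg : Finset.map Fin.valEmbedding '' (sets T : Set (Finset (Fin M))) = triangles S := by
    ext s
    constructor
    · rintro ⟨t, ht, rfl⟩
      obtain ⟨_, ht⟩ := mem_sets.1 ht
      exact (Finset.mem_filter.1 ht).2
    · intro hs
      have hmap : (s.attachFin (hM s hs)).map Fin.valEmbedding = s :=
        Finset.map_valEmbedding_attachFin _
      refine ⟨s.attachFin (hM s hs), mem_sets.2 ⟨?_, Finset.mem_filter.2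
        ⟨Finset.mem_univ _, ?_⟩⟩, hmap⟩
      · rw [Finset.card_attachFin, hs.2]
      · rwa [hmap]
  refine ⟨M, T, hM1, ?_, fun H hHT hne => ?_⟩
  · rw [← himg, core_iterate_image] at hcore
    exact hcore.of_image
  · set G : Finset (Finset ℕ) := (sets H).image (Finset.map Fin.valEmbedding) with hG
    have hGS : (G : Set (Finset ℕ)) ⊆ triangles S := by
      rw [← himg, hG, Finset.coe_image]
      exact Set.image_mono (Finset.coe_subset.2 (sets_subset_sets.2 hHT))
    have hG3 : ∀ t ∈ G, t.card = 3 := fun t ht => (hGS ht).2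
    have hGcard : G.card = H.card := by
      rw [hG, Finset.card_image_of_injective _ (Finset.map_injective _), card_sets]
    have hle : gen (G : Set (Finset ℕ)) ≤ S := by
      rintro s ⟨hs, t, ht, hst⟩
      exact face_of_subset S (hGS ht).1 hst hs
    have hHpos := hne.card_pos
    have hmu := muTilde_le hle (by rw [numTriangles_gen hG3, hGcard]; exact hHpos)
    rw [mu, numVertices_gen, numTriangles_gen hG3, hGcard,
      le_div_iff₀ (by exact_mod_cast hHpos)] at hmu
    have hsupp : supp G ⊆ (supp (sets H)).map Fin.valEmbedding := by
      intro v hv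
      obtain ⟨_, ht, hvt⟩ := Finset.mem_biUnion.1 hv
      obtain ⟨t, ht', rfl⟩ := Finset.mem_image.1 ht
      exact (Finset.map_subset_map (f := Fin.valEmbedding)).2 (subset_supp ht') hvt
    have := Finset.card_le_card hsupp
    rw [Finset.card_map] at this
    exact hmu.trans (by exact_mod_cast this)

theorem tendsto_bern_of_not {p : ℕ → ℝ} {Q : ∀ n, Finset (Triple n) → Prop}
    (h : Tendsto (fun n => bern (p n) fun F => ¬ Q n F) atTop (𝓝 0)) :
    Tendsto (fun n => bern (p n) (Q n)) atTop (𝓝 1) := by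
  have : (fun n => bern (p n) (Q n)) = fun n => 1 - bern (p n) fun F => ¬ Q n F :=
    funext fun n => eq_sub_of_add_eq (bern_add_bern_not _ _)
  rw [this]
  simpa using h.const_sub 1

theorem tendsto_prob_collapsible (hk : 1 ≤ k) (hr : 2 ≤ r) {p : ℕ → ℝ}
    (hp : ∀ n, 0 < p n ∧ p n < 1)
    (h1 : MuchLess p (fun n => (n : ℝ) ^ (-1 - 2 / ((r : ℝ) + 1))))
    (h2 : MuchLess p (fun n => (n : ℝ) ^ (-muTildeMax k r))) :
    Tendsto (fun n => prob n (p n) (fun Y => CollapsibleToGraph k Y)) atTop (𝓝 1) := by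
  simp only [prob_eq_bern]
  refine tendsto_bern_of_not ?_
  have h1' : MuchLess p (fun n => (n : ℝ) ^ (-(1 + 2 / ((r : ℝ) + 1)))) := by
    rw [neg_add, ← sub_eq_add_neg]
    exact h1
  have hlim := (tendsto_bern_hasDense hp (r + 1) h1').add
    (tendsto_bern_hasDense hp ((3 * r) ^ k) h2)
  rw [add_zero] at hlim
  refine squeeze_zero (fun n => bern_nonneg (hp n).1.le (hp n).2.le _) (fun n => ?_) hlim
  exact (bern_mono (hp n).1.le (hp n).2.le fun F hF =>
    hasDense_of_not_collapsible hk hr F hF).trans (bern_or_le (hp n).1.le (hp n).2.le _ _)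

theorem tendsto_prob_not_collapsible (hk : 1 ≤ k) (hr : 2 ≤ r) {p : ℕ → ℝ}
    (hp : ∀ n, 0 < p n ∧ p n < 1)
    (h : MuchLess (fun n => (n : ℝ) ^ (-muTildeMax k r)) p) :
    Tendsto (fun n => prob n (p n) (fun Y => ¬ CollapsibleToGraph k Y)) atTop (𝓝 1) := by
  obtain ⟨S, hS, hmax⟩ := (isGreatest_muTildeMax hk hr).1
  obtain ⟨M, T, hM, hcore, hT⟩ := exists_triples_of_forbidden hk hS
  rw [hmax] at hT
  simp only [prob_eq_bern]
  refine tendsto_bern_of_not ?_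
  refine squeeze_zero (fun n => bern_nonneg (hp n).1.le (hp n).2.le _) (fun n => ?_)
    (tendsto_bern_forall_not_map_subset hp h hM T hT)
  -- By monotonicity of `core`, a copy of `T` inside `F` keeps its surviving triangle alive in `F`.
  refine bern_mono (hp n).1.le (hp n).2.le fun F hF g hg => hF fun hcol => ?_
  rw [collapsibleToGraph_iff (dimLE_ofTriangles F), triangles_ofTriangles] at hcol
  have hsub := core_iterate_mono (Finset.coe_subset.2 (sets_subset_sets.2 hg)) k
  rw [hcol, sets_map, core_iterate_image] at hsub
  exact Set.not_nonempty_empty ((hcore.image _).mono hsub)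

end Threshold

end RandomComplex

open RandomComplex
theorem mainTheorem4 (k r : ℕ) (hk : 1 ≤ k) (hr : 2 ≤ r) :
    IsGreatest (muTilde '' forbidden k r) (muTildeMax k r) ∧
    ∀ p : ℕ → ℝ, (∀ n, 0 < p n ∧ p n < 1) →
      ((MuchLess p (fun n => (n : ℝ) ^ (-1 - 2 / ((r : ℝ) + 1))) ∧
          MuchLess p (fun n => (n : ℝ) ^ (-muTildeMax k r)) →
        Tendsto (fun n => prob n (p n) (fun Y => CollapsibleToGraph k Y)) atTop (𝓝 1)) ∧
      (MuchLess (fun n => (n : ℝ) ^ (-muTildeMax k r)) p →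
        Tendsto (fun n => prob n (p n) (fun Y => ¬ CollapsibleToGraph k Y)) atTop (𝓝 1))) :=
  ⟨isGreatest_muTildeMax hk hr, fun _ hp =>
    ⟨fun h => tendsto_prob_collapsible hk hr hp h.1 h.2,
      fun h => tendsto_prob_not_collapsible hk hr hp h⟩⟩
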